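/- **Conventions.** Definable sets are allowed parameters unless said otherwise. A *monster model* is a structure $M$ in a language $L$ which, for some cardinal $\kappa>\max(\aleph_0,|L|)$, is $\kappa$-saturated and strongly $\kappa$-homogeneous; sets of size $<\kappa$ are called small. A *matroid* on $M$ is a closure operator $\mathrm{cl}:\mathcal P(M)\to\mathcal P(M)$ (extensive, monotone, idempotent) which is finitary and satisfies exchange: $a\in\mathrm{cl}(Xc)\setminus\mathrm{cl}(X)$ implies $c\in\mathrm{cl}(Xa)$. A parameter-free formula $\phi(x,\bar y)$ is *narrow* if $M\models\phi(a,\bar b)$ implies $a\in\mathrm{cl}(\bar b)$. The matroid is *existential* if: for all $A$, $\mathrm{cl}(A)$ is the union of the sets $\phi(M,\bar a)$ with $\phi$ narrow and $\bar a$ in $A$; for every $a$ and all small $B,C$ with $a\notin\mathrm{cl}(B)$ there is $a'\equiv_B a$ with $a'\notin\mathrm{cl}(BC)$; and $\mathrm{cl}$ is not the operator with constant value $M$. Its *dimension* $\dim^{\mathrm{cl}}(V)$, for $V\subseteq M^n$ definable with finite parameter set $A$, is the maximum of the ranks over $A$ of the tuples in $V$, and $-\infty$ if $V=\emptyset$ (this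 does not depend on $A$). A *dimension function* on a structure $K$ is a function $d$ from the definable subsets of the powers of $K$ to $\{-\infty\}\cup\mathbb N$ such that, for all $m\in\mathbb N$ and definable $S,S_1,S_2\subseteq K^m$: 1. $d(S)=-\infty$ iff $S=\emptyset$; $d(\{a\})=0$ for $a\in K$; $d(K)=1$. 2. $d(S_1\cup S_2)=\max(d(S_1),d(S_2))$. 3. $d(S^\sigma)=d(S)$ for every permutation $\sigma$ of the coordinates. 4. If $U\subseteq K^{m+1}$ is definable and $U(i)=\{x\in K^m: d(U_x)=i\}$ for $i=0,1$, then $U(i)$ is definable over any set of parameters over which $U$ is, and $d(U\cap\pi^{-1}(U(i)))=d(U(i))+i$, where $\pi:K^{m+1}\to K^m$ is the projection onto the first $m$ coordinates and $U_x\subseteq K$ is the fibre over $x$. It induces the operator $\mathrm{cl}^d$: $b\in\mathrm{cl}^d(A)$ iff $b\in X$ for some $A$-definable $X\subseteq K$ with $d(X)=0$. **Setting.** Let $I$ be an infinite set, $\mu$ an ultrafilter on $I$ and, for every $i\in I$, let $K_i$ be an $L$-structure with an existential matroid $\mathrm{cl}_i$, i.e. $K_i\preceq M_i$ where $M_i$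 is a monster model and $\mathrm{cl}_i$ is an existential matroid on $M_i$ (possibly $K_i=M_i$). For $X=\phi(K_i,\bar b)$ definable in $K_i$ put $d_i(X)=\dim^{\mathrm{cl}_i}(\phi(M_i,\bar b))$. The dimension is *uniformly definable* if for every parameter-free formula $\phi(\bar x,\bar y)$, $\bar x=(x_1,\dots,x_n)$, and every $l\le n$ there is a parameter-free formula $\psi(\bar y)$ such that, for every $i\in I$ and every $\bar b$ in $M_i$, $\dim^{\mathrm{cl}_i}(\phi(M_i,\bar b))=l$ iff $M_i\models\psi(\bar b)$. Let $K=\prod_i K_i/\mu$. **Theorem.** (0) If there are symbols $0,1,+,\cdot$ of $L$ for which every $K_i$ expands a ring without zero divisors, then the dimension is uniformly definable. Assume now that the dimension is uniformly definable. (1) Every definable $X\subseteq K^n$ is of the form $\prod_i X_i/\mu$ with $X_i\subseteq K_i^n$ definable, and there is a value $d(X)$, independent of the choice of such $X_i$, with $d_i(X_i)=d(X)$ for $\mu$-almost every $i$. The function $d$ is a dimension function on $K$. (2) $d$ induces an existential matroid on $K$: for every monster model $N\succeq K$, $d$ extends to a dimension function $d'$ on $N$ (that is, $d'(\phi(N,\bar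 b))=d(\phi(K,\bar b))$ for all parameter-free formulas $\phi(\bar x,\bar y)$ and all $\bar b$ in $K$); and, for every such $d'$, $\mathrm{cl}^{d'}$ is an existential matroid on $N$, its dimension is $d'$, and $\mathrm{cl}^{d'}(A)\cap K=\mathrm{cl}^d(A)$ for all $A\subseteq K$. (3) If $a=[a_i]_\mu\in K$ and $\bar b=[\bar b_i]_\mu$ is a finite tuple of $K$ with $a\in\mathrm{cl}^d(\bar b)$, then $a_i\in\mathrm{cl}_i(\bar b_i)$ for $\mu$-almost every $i$. (4) The converse of (3) is not true: there are a family $(K_i,M_i,\mathrm{cl}_i)_{i\in I}$ as above with uniformly definable dimension, an ultrafilter $\mu$ on $I$, an element $a=[a_i]_\mu$ and a finite tuple $\bar b=[\bar b_i]_\mu$ of $K$ such that $a_i\in\mathrm{cl}_i(\bar b_i)$ for $\mu$-almost every $i$, but $a\notin\mathrm{cl}^d(\bar b)$. -/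

import Mathlib

open FirstOrder Filter Set
open scoped Cardinal FirstOrder

universe u v w x y z

noncomputable section

namespace ExistentialMatroid

/-! ### Monster models -/

section Monster

variable (L : FirstOrder.Language.{u, v}) {M : Type x} [L.Structure M]

/-- `κ`-saturation: every set of formulas in one variable, with parameters in a set of fewer than
`κ` elements, which is finitely satisfiable in `M`, is realised in `M`. -/
def IsSaturated (κ : Cardinal.{x}) (M : Type x) [L.Structure M] : Prop :=
  ∀ A : Set M, #A < κ → ∀ p : Set (L[[A]].Formula (Fin 1)),
    (∀ q : Finset (L[[A]].Formula (Fin 1)), (q : Set (L[[A]].Formula (Fin 1))) ⊆ p →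
      ∃ a : M, ∀ φ ∈ q, φ.Realize (fun _ => a)) →
    ∃ a : M, ∀ φ ∈ p, φ.Realize (fun _ => a)

/-- Strong `κ`-homogeneity: every partial elementary map of `M` into itself, whose domain has fewer
than `κ` elements, extends to an automorphism of `M`. -/
def IsStronglyHomogeneous (κ : Cardinal.{x}) (M : Type x) [L.Structure M] : Prop :=
  ∀ A : Set M, #A < κ → ∀ f : A → M,
    (∀ φ : L.Formula A, φ.Realize ((↑) : A → M) ↔ φ.Realize f) →
    ∃ σ : M ≃[L] M, ∀ a : A, σ (a : M) = f a

/-- `M` is a monster model of its theory `T`, with respect to a cardinal `κ > |T|`, where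
`|T|` is the maximum of `ℵ₀` and of the number of symbols of the language. -/
structure IsMonster (κ : Cardinal.{x}) (M : Type x) [L.Structure M] : Prop where
  card_lt : Cardinal.lift.{x} (max ℵ₀ L.card) < Cardinal.lift.{max u v} κ
  saturated : IsSaturated L κ M
  homogeneous : IsStronglyHomogeneous L κ M

end Monster

/-! ### Existential matroids -/

section Matroid

variable (L : FirstOrder.Language.{u, v}) {M : Type x} [L.Structure M]

/-- The set `φ(M, b)`, for a formula `φ(x, y)` without parameters. -/
def fiber {L : FirstOrder.Language.{u, v}} {M : Type x} [L.Structure M] {n m : ℕ}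
    (φ : L.Formula (Fin n ⊕ Fin m)) (b : Fin m → M) : Set (Fin n → M) :=
  {a | φ.Realize (Sum.elim a b)}

/-- `φ(x, y)` is `x`-narrow: `M ⊨ φ(a, b)` implies `a ∈ cl(b)`. -/
def IsNarrow (cl : Set M → Set M) {m : ℕ} (φ : L.Formula (Fin 1 ⊕ Fin m)) : Prop :=
  ∀ (b : Fin m → M) (a : M), (fun _ => a) ∈ fiber φ b → a ∈ cl (range b)

/-- `a ≡_B a'`: the elements `a` and `a'` have the same type over `B`. -/
def SameType (B : Set M) (a a' : M) : Prop :=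
  ∀ (m : ℕ) (φ : L.Formula (Fin 1 ⊕ Fin m)) (b : Fin m → M), (∀ k, b k ∈ B) →
    ((fun _ => a) ∈ fiber φ b ↔ (fun _ => a') ∈ fiber φ b)

/-- `cl` is an existential matroid on the monster model `M`: a finitary matroid which is definable,
satisfies the Existence axiom (for small sets `B`, `C`) and is not the trivial matroid, whose
closure of every set is the whole of `M`. -/
structure IsExistentialMatroid (κ : Cardinal.{x}) (cl : Set M → Set M) : Prop where
  extension : ∀ X, X ⊆ cl X
  monotone : ∀ X Y, X ⊆ Y → cl X ⊆ cl Y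
  idempotent : ∀ X, cl (cl X) = cl X
  finitary : ∀ X, cl X = ⋃ A ∈ {A : Set M | A ⊆ X ∧ A.Finite}, cl A
  exchange : ∀ (X : Set M) (a c : M), a ∈ cl (insert c X) → a ∉ cl X → c ∈ cl (insert a X)
  definable : ∀ (A : Set M) (a : M), a ∈ cl A ↔
    ∃ (m : ℕ) (φ : L.Formula (Fin 1 ⊕ Fin m)) (b : Fin m → M),
      IsNarrow L cl φ ∧ (∀ k, b k ∈ A) ∧ (fun _ => a) ∈ fiber φ b
  existence : ∀ (a : M) (B C : Set M), #B < κ → #C < κ → a ∉ cl B →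
    ∃ a', SameType L B a a' ∧ a' ∉ cl (B ∪ C)
  nontrivial : ∃ X, cl X ≠ univ

/-- The subtuple of `b` with indices in `s` is independent over `A`. -/
def IsIndependent (cl : Set M → Set M) (A : Set M) {n : ℕ} (b : Fin n → M)
    (s : Finset (Fin n)) : Prop :=
  ∀ k ∈ s, b k ∉ cl (A ∪ b '' {l | l ∈ s ∧ l ≠ k})

/-- The rank of the tuple `b` over `A`: the largest size of a subtuple independent over `A`. -/
def rank (cl : Set M → Set M) (A : Set M) {n : ℕ} (b : Fin n → M) : ℕ :=
  sSup {k | ∃ s : Finset (Fin n), s.card = k ∧ IsIndependent cl A b s}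

open Classical in
/-- The maximum of the ranks over `A` of the elements of `V`, with value `-∞ = ⊥` at `∅`. -/
def dimOver (cl : Set M → Set M) (A : Set M) {n : ℕ} (V : Set (Fin n → M)) : WithBot ℕ :=
  if V = ∅ then ⊥ else ((sSup {k | ∃ b ∈ V, k = rank cl A b} : ℕ) : WithBot ℕ)

open Classical in
/-- The dimension, with respect to `cl`, of the definable set `V`: the maximum of the ranks of its
elements over a finite set `A` of parameters that define `V`. For an existential matroid on a
monster model, this does not depend on the choice of `A`. -/
def dim (cl : Set M → Set M) {n : ℕ} (V : Set (Fin n → M)) : WithBot ℕ :=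
  if h : ∃ A : Set M, A.Finite ∧ A.Definable L V then dimOver cl h.choose V else ⊥

end Matroid

/-! ### Dimension functions -/

section DimensionFunction

variable (L : FirstOrder.Language.{u, v}) {K : Type x} [L.Structure K]

/-- The fibre `U_t` of `U ⊆ K^{m+1}` over `t ∈ K^m`, as a subset of `K^1`. -/
def lastFiber {m : ℕ} (U : Set (Fin (m + 1) → K)) (t : Fin m → K) : Set (Fin 1 → K) :=
  {c | Fin.snoc (α := fun _ => K) t (c 0) ∈ U}

/-- `d` is a dimension function on `K`. Only the values of `d` at sets which are definable (with
parameters) in `K` matter; `⊥` stands for `-∞`. -/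
structure IsDimensionFunction (d : ∀ n : ℕ, Set (Fin n → K) → WithBot ℕ) : Prop where
  eq_bot_iff : ∀ (m : ℕ) (S : Set (Fin m → K)), univ.Definable L S → (d m S = ⊥ ↔ S = ∅)
  singleton : ∀ a : K, d 1 {fun _ => a} = 0
  line : d 1 univ = 1
  union : ∀ (m : ℕ) (S₁ S₂ : Set (Fin m → K)), univ.Definable L S₁ → univ.Definable L S₂ →
    d m (S₁ ∪ S₂) = max (d m S₁) (d m S₂)
  perm : ∀ (m : ℕ) (S : Set (Fin m → K)) (σ : Equiv.Perm (Fin m)), univ.Definable L S →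
    d m ((fun t => t ∘ σ) '' S) = d m S
  fiber_definable : ∀ (m : ℕ) (A : Set K) (U : Set (Fin (m + 1) → K)), A.Definable L U →
    ∀ i : ℕ, i ≤ 1 → A.Definable L {t | d 1 (lastFiber U t) = (i : WithBot ℕ)}
  fiber_add : ∀ (m : ℕ) (U : Set (Fin (m + 1) → K)), univ.Definable L U → ∀ i : ℕ, i ≤ 1 →
    d (m + 1) (U ∩ {t | d 1 (lastFiber U (Fin.init t)) = (i : WithBot ℕ)}) =
      d m {t | d 1 (lastFiber U t) = (i : WithBot ℕ)} + (i : WithBot ℕ)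

/-- The operator `cl^d` induced by `d`: `b ∈ cl^d(A)` iff `b` belongs to some `A`-definable set
`X ⊆ K` with `d(X) = 0`. -/
def matroidOfDim (d : ∀ n : ℕ, Set (Fin n → K) → WithBot ℕ) (A : Set K) : Set K :=
  {b | ∃ X : Set (Fin 1 → K), A.Definable L X ∧ d 1 X = 0 ∧ (fun _ => b) ∈ X}

/-- For an elementary embedding `j : K → N`: the function `d'` on the definable sets of `N` extends
`d`, that is, `d'(φ(N, b)) = d(φ(K, b))` for all formulas `φ` and all parameters `b` in `K`. -/
def ExtendsDim {L : FirstOrder.Language.{u, v}} {K : Type x} [L.Structure K] {N : Type y} [L.Structure N]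
    (j : K ↪ₑ[L] N) (d : ∀ n : ℕ, Set (Fin n → K) → WithBot ℕ)
    (d' : ∀ n : ℕ, Set (Fin n → N) → WithBot ℕ) : Prop :=
  ∀ (n m : ℕ) (φ : L.Formula (Fin n ⊕ Fin m)) (b : Fin m → K),
    d' n (fiber φ (j ∘ b)) = d n (fiber φ b)

/-- The canonical extension to `M` of a definable subset `X` of `K^n`: if `X = φ(K, b)`, then it is
`φ(M, b)`, which does not depend on the choice of `φ` and `b`. -/
def extendSet {L : FirstOrder.Language.{u, v}} {K : Type x} [L.Structure K] {M : Type y} [L.Structure M]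
    (j : K ↪ₑ[L] M) {n : ℕ} (X : Set (Fin n → K)) : Set (Fin n → M) :=
  {a | ∃ (m : ℕ) (φ : L.Formula (Fin n ⊕ Fin m)) (b : Fin m → K),
    X = fiber φ b ∧ a ∈ fiber φ (j ∘ b)}

/-- The dimension induced on the definable sets of `K` by an operator `cl` on the elementary
extension `M` of `K`. -/
def inducedDim {L : FirstOrder.Language.{u, v}} {K : Type x} [L.Structure K] {M : Type y} [L.Structure M]
    (j : K ↪ₑ[L] M) (cl : Set M → Set M) (n : ℕ) (X : Set (Fin n → K)) : WithBot ℕ :=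
  dim L cl (extendSet j X)

end DimensionFunction

/-! ### Families and ultraproducts -/

section Ultraproduct

variable {L : FirstOrder.Language.{u, v}} {I : Type w}

/-- The dimension is uniformly definable for the family `(M i, cl i)`. -/
def UniformlyDefinable (L : FirstOrder.Language.{u, v}) {I : Type w} {M : I → Type y}
    [∀ i, L.Structure (M i)] (cl : ∀ i, Set (M i) → Set (M i)) : Prop :=
  ∀ (n m : ℕ) (φ : L.Formula (Fin n ⊕ Fin m)) (l : ℕ), l ≤ n →
    ∃ ψ : L.Formula (Fin m), ∀ (i : I) (b : Fin m → M i),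
      dim L (cl i) (fiber φ b) = (l : WithBot ℕ) ↔ ψ.Realize b

/-- A choice, in the language `L`, of symbols `0, 1, +, ·` of the language of rings. -/
structure RingSymbols (L : FirstOrder.Language.{u, v}) where
  zero : L.Functions 0
  one : L.Functions 0
  add : L.Functions 2
  mul : L.Functions 2

/-- With the chosen symbols, the structure `K` expands a ring without zero divisors. -/
def ExpandsDomain (s : RingSymbols L) (K : Type x) [L.Structure K] : Prop :=
  ∃ _ : Ring K, NoZeroDivisors K ∧
    FirstOrder.Language.Structure.funMap s.zero ![] = (0 : K) ∧
    FirstOrder.Language.Structure.funMap s.one ![] = (1 : K) ∧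
    (∀ a b : K, FirstOrder.Language.Structure.funMap s.add ![a, b] = a + b) ∧
    (∀ a b : K, FirstOrder.Language.Structure.funMap s.mul ![a, b] = a * b)

/-- The element of the ultraproduct represented by `a`. -/
def ultraMk (μ : Ultrafilter I) {K : I → Type x} (a : ∀ i, K i) : (μ : Filter I).Product K := a

/-- The subset `Π_i X_i / μ` of the `n`-th power of the ultraproduct. -/
def ultraSet (μ : Ultrafilter I) {K : I → Type x} {n : ℕ} (X : ∀ i, Set (Fin n → K i)) :
    Set (Fin n → (μ : Filter I).Product K) :=
  {t | ∃ a : Fin n → ∀ i, K i, t = (fun k => ultraMk μ (a k)) ∧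
    ∀ᶠ i in (μ : Filter I), (fun k => a k i) ∈ X i}

open Classical in
/-- The ultralimit of the functions `D i` on definable sets: its value at `X = Π_i X_i / μ`, with
each `X_i` definable, is `l` if `D i (X_i) = l` for `μ`-almost every `i`. -/
def ultraDim (L : FirstOrder.Language.{u, v}) (μ : Ultrafilter I) {K : I → Type x}
    [∀ i, L.Structure (K i)] (D : ∀ i, ∀ n : ℕ, Set (Fin n → K i) → WithBot ℕ) (n : ℕ)
    (X : Set (Fin n → (μ : Filter I).Product K)) : WithBot ℕ :=
  if h : ∃ l : WithBot ℕ, ∃ Y : ∀ i, Set (Fin n → K i), (∀ i, univ.Definable L (Y i)) ∧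
      X = ultraSet μ Y ∧ ∀ᶠ i in (μ : Filter I), D i n (Y i) = l
  then h.choose else ⊥

/-- The ultralimit of the dimensions induced on the structures `K i` by the operators `cl i`. -/
def limitDim (μ : Ultrafilter I) {K : I → Type x} [∀ i, L.Structure (K i)] {M : I → Type y}
    [∀ i, L.Structure (M i)] (j : ∀ i, K i ↪ₑ[L] M i) (cl : ∀ i, Set (M i) → Set (M i)) :
    ∀ n : ℕ, Set (Fin n → (μ : Filter I).Product K) → WithBot ℕ :=
  ultraDim L μ (fun i => inducedDim (j i) (cl i))

end Ultraproduct

end ExistentialMatroid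

end

namespace ExistentialMatroid

open FirstOrder.Language

/-! ### Definable sets as fibers of formulas -/

section Formulas

variable {L : FirstOrder.Language.{u, v}} {M : Type x} [L.Structure M]

/-! The argument turns the axioms of a dimension function into first-order statements. Uniform
definability supplies parameter-free formulas `Ψ`, the same for all `i`, that express "the fibre of
`φ` has dimension `l`" in every `M i`. On a monster model with an existential matroid, the dimension
satisfies the axioms: it does not depend on the parameters (`dim_eq_dimOver`), since every tuple has
a conjugate whose rank does not drop over more parameters (`exists_generic_tuple`), and it is
additive over fibres (`dim_fiber_add`). Written with `Ψ`, the axioms become formulas valid in every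
`M i`, hence in every `K i`, in the ultraproduct by Łoś, and in every elementary extension of it. So
any function represented by `Ψ` there is a dimension function (`isDimensionFunction_of_represents`).
The ultralimit is such a function (`represents_limitDim`), and on a monster extension `Ψ` itself
defines one (`represents_dimOfFormulas`).

Conversely, a dimension function on a monster model induces an existential matroid
(`isExistentialMatroid`). Idempotence and exchange come from measuring a binary relation along both
of its projections, existence from saturation. The matroid returns the given dimension
(`dim_matroidOfDim`), because both functions are additive and agree on the line.

For rings without zero divisors, `X` has dimension one iff every `a` satisfies `x + a * y = x' + a *
y'` for some points of `X` with `y ≠ y'`. Otherwise `(x, y) ↦ x + a * y` is injective on `X × X`,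
and a single element would have rank two (`dim_eq_one_iff_of_separates`).

Closure in the ultraproduct is witnessed by one formula, whose fibres have dimension zero almost
everywhere; this gives (3). The converse fails because membership in `cl i` may need a different
formula for each `i`: with countably many named points in a pure set, a nonstandard point is in no
small set defined by one formula (`point_notMem_matroidOfDim`). -/

theorem mem_fiber {n m : ℕ} {φ : L.Formula (Fin n ⊕ Fin m)} {b : Fin m → M} {a : Fin n → M} :
    a ∈ fiber φ b ↔ φ.Realize (Sum.elim a b) := Iff.rfl

theorem mem_fiber_relabel {α : Type*} {n' m' : ℕ} {φ : L.Formula α}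
    {g : α → Fin n' ⊕ Fin m'} {b : Fin m' → M} {a : Fin n' → M} :
    a ∈ fiber (φ.relabel g) b ↔ φ.Realize (Sum.elim a b ∘ g) :=
  Formula.realize_relabel

theorem definable_fiber {n m : ℕ} (φ : L.Formula (Fin n ⊕ Fin m)) {b : Fin m → M} {A : Set M}
    (hb : ∀ k, b k ∈ A) : A.Definable L (fiber φ b) := by
  rw [definable_iff_exists_formula_sum]
  refine ⟨φ.relabel (Sum.elim Sum.inr fun k => Sum.inl ⟨b k, hb k⟩), ?_⟩
  ext a
  rw [mem_fiber, mem_ofPred_eq, Formula.realize_relabel, Sum.comp_elim]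
  rfl

/-- A formula uses finitely many of its parameters. Presenting definable sets by a parameter-free
formula and a finite tuple lets the formula move between structures. -/
theorem definable_iff_fiber {n : ℕ} {A : Set M} {S : Set (Fin n → M)} :
    A.Definable L S ↔
      ∃ (m : ℕ) (φ : L.Formula (Fin n ⊕ Fin m)) (b : Fin m → M), (∀ k, b k ∈ A) ∧ S = fiber φ b := by
  constructor
  · intro h
    obtain ⟨A₀, hA₀, h⟩ := definable_iff_finitely_definable.1 h
    obtain ⟨φ, rfl⟩ := definable_iff_exists_formula_sum.1 h
    let e := Finite.equivFin ((A₀ : Set M) : Type x)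
    refine ⟨_, φ.relabel (Sum.elim (Sum.inr ∘ e) Sum.inl), fun k => e.symm k,
      fun k => hA₀ (e.symm k).2, ?_⟩
    ext a
    refine Iff.trans ?_ mem_fiber_relabel.symm
    rw [mem_ofPred_eq, Sum.comp_elim]
    have : ((Sum.elim a fun k => ((e.symm k : (A₀ : Set M)) : M)) ∘ Sum.inr ∘ e) =
        fun k : (A₀ : Set M) => (k : M) := by
      ext k; simp
    rw [this]; rfl
  · rintro ⟨m, φ, b, hb, rfl⟩
    exact definable_fiber φ hb

theorem exists_finite_definable {n : ℕ} {A : Set M} {S : Set (Fin n → M)} (h : A.Definable L S) :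
    ∃ B ⊆ A, B.Finite ∧ B.Definable L S := by
  obtain ⟨A₀, hA₀, h⟩ := definable_iff_finitely_definable.1 h
  exact ⟨A₀, hA₀, A₀.finite_toSet, h⟩

/-- The formula for the fibres over the first coordinates, which become parameters. -/
def lastFormula {m p : ℕ} (φ : L.Formula (Fin (m + 1) ⊕ Fin p)) : L.Formula (Fin 1 ⊕ Fin (m + p)) :=
  φ.relabel (Sum.elim (Fin.lastCases (Sum.inl 0) fun k => Sum.inr (Fin.castAdd p k))
    fun k => Sum.inr (Fin.natAdd m k))

theorem lastFiber_fiber {m p : ℕ} (φ : L.Formula (Fin (m + 1) ⊕ Fin p)) (b : Fin p → M)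
    (t : Fin m → M) : lastFiber (fiber φ b) t = fiber (lastFormula φ) (Fin.append t b) := by
  ext c
  rw [lastFormula, mem_fiber_relabel]
  change φ.Realize _ ↔ _
  rw [iff_iff_eq]
  congr 1
  ext k
  rcases k with k | k
  · induction k using Fin.lastCases <;> simp
  · simp

theorem definable_lastFiber {m : ℕ} {A : Set M} {U : Set (Fin (m + 1) → M)} (hU : A.Definable L U)
    (t : Fin m → M) : (A ∪ range t).Definable L (lastFiber U t) := by
  obtain ⟨p, φ, b, hb, rfl⟩ := definable_iff_fiber.1 hU
  rw [lastFiber_fiber]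
  refine definable_fiber _ fun k => ?_
  induction k using Fin.addCases with
  | left k => simp
  | right k => simp [hb k]

/-- Two definable sets are defined with the same parameters. -/
theorem exists_common_fiber {n n' : ℕ} {A : Set M} {S : Set (Fin n → M)} {S' : Set (Fin n' → M)}
    (h : A.Definable L S) (h' : A.Definable L S') :
    ∃ (m : ℕ) (φ : L.Formula (Fin n ⊕ Fin m)) (φ' : L.Formula (Fin n' ⊕ Fin m)) (b : Fin m → M),
      (∀ k, b k ∈ A) ∧ S = fiber φ b ∧ S' = fiber φ' b := by
  obtain ⟨m, φ, b, hb, rfl⟩ := definable_iff_fiber.1 h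
  obtain ⟨m', φ', b', hb', rfl⟩ := definable_iff_fiber.1 h'
  refine ⟨m + m', φ.relabel (Sum.map id (Fin.castAdd m')), φ'.relabel (Sum.map id (Fin.natAdd m)),
    Fin.append b b', fun k => ?_, ?_, ?_⟩
  · induction k using Fin.addCases <;> simp [hb, hb']
  · ext a
    rw [mem_fiber_relabel, mem_fiber, Sum.elim_comp_map]
    simp [Function.comp_def]
  · ext a
    rw [mem_fiber_relabel, mem_fiber, Sum.elim_comp_map]
    simp [Function.comp_def]

theorem comp_mem_fiber_comp {N : Type y} [L.Structure N] (e : M ↪ₑ[L] N) {n m : ℕ}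
    (φ : L.Formula (Fin n ⊕ Fin m)) (b : Fin m → M) (a : Fin n → M) :
    e ∘ a ∈ fiber φ (e ∘ b) ↔ a ∈ fiber φ b := by
  rw [mem_fiber, mem_fiber, ← Sum.comp_elim, e.map_formula]

theorem equiv_comp_mem_fiber {n m : ℕ} (σ : M ≃[L] M) (φ : L.Formula (Fin n ⊕ Fin m))
    (b : Fin m → M) (a : Fin n → M) : σ ∘ a ∈ fiber φ (σ ∘ b) ↔ a ∈ fiber φ b :=
  comp_mem_fiber_comp σ.toElementaryEmbedding φ b a

theorem equiv_comp_mem_iff {n : ℕ} {A : Set M} {V : Set (Fin n → M)} (hV : A.Definable L V)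
    (σ : M ≃[L] M) (hσ : ∀ x ∈ A, σ x = x) (a : Fin n → M) : σ ∘ a ∈ V ↔ a ∈ V := by
  obtain ⟨p, φ, b, hb, rfl⟩ := definable_iff_fiber.1 hV
  conv_lhs => rw [show b = σ ∘ b from funext fun k => (hσ _ (hb k)).symm]
  exact equiv_comp_mem_fiber σ φ b a

/-- The formula expressing that two fibres coincide. -/
noncomputable def sameFiber {n m m' : ℕ} (φ : L.Formula (Fin n ⊕ Fin m)) (φ' : L.Formula (Fin n ⊕ Fin m')) :
    L.Formula (Fin m ⊕ Fin m') :=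
  Formula.iAlls (Fin n) ((φ.relabel (Sum.elim Sum.inr (Sum.inl ∘ Sum.inl))).iff
    (φ'.relabel (Sum.elim Sum.inr (Sum.inl ∘ Sum.inr))))

theorem realize_sameFiber {n m m' : ℕ} {φ : L.Formula (Fin n ⊕ Fin m)}
    {φ' : L.Formula (Fin n ⊕ Fin m')} {b : Fin m → M} {b' : Fin m' → M} :
    (sameFiber φ φ').Realize (Sum.elim b b') ↔ ∀ a, a ∈ fiber φ b ↔ a ∈ fiber φ' b' := by
  rw [sameFiber, Formula.realize_iAlls]
  refine forall_congr' fun a => ?_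
  simp only [Formula.realize_iff, Formula.realize_relabel, Sum.comp_elim, mem_fiber,
    ← Function.comp_assoc, Sum.elim_comp_inr, Sum.elim_comp_inl]

/-- Coincidence of two fibres is a first-order property of their parameters. This makes `extendSet`
independent of the presentation. -/
theorem fiber_elementary_eq {N : Type y} [L.Structure N] (e : M ↪ₑ[L] N) {n m m' : ℕ}
    {φ : L.Formula (Fin n ⊕ Fin m)} {φ' : L.Formula (Fin n ⊕ Fin m')} {b : Fin m → M}
    {b' : Fin m' → M} (h : fiber φ b = fiber φ' b') : fiber φ (e ∘ b) = fiber φ' (e ∘ b') := by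
  ext a
  revert a
  rw [← realize_sameFiber, ← Sum.comp_elim, e.map_formula, realize_sameFiber]
  simp [h]

theorem extendSet_fiber {N : Type y} [L.Structure N] (e : M ↪ₑ[L] N) {n m : ℕ}
    (φ : L.Formula (Fin n ⊕ Fin m)) (b : Fin m → M) :
    extendSet e (fiber φ b) = fiber φ (e ∘ b) := by
  ext a
  constructor
  · rintro ⟨m', φ', b', h, ha⟩
    rwa [fiber_elementary_eq e h]
  · exact fun ha => ⟨m, φ, b, rfl, ha⟩

/-- Dimensions are compared through their lower bounds in `ℕ`, because these are existential
statements about tuples and treat the empty set without a case distinction. -/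
theorem withBot_ext {x y : WithBot ℕ} (h : ∀ l : ℕ, (l : WithBot ℕ) ≤ x ↔ (l : WithBot ℕ) ≤ y) :
    x = y := by
  apply le_antisymm
  · induction x with
    | bot => exact bot_le
    | coe x => exact (h x).1 le_rfl
  · induction y with
    | bot => exact bot_le
    | coe y => exact (h y).2 le_rfl

end Formulas

/-! ### Ranks of tuples -/

section Rank

variable {M : Type x} {cl : Set M → Set M} {A : Set M} {n : ℕ} {b : Fin n → M}

theorem isIndependent_empty : IsIndependent cl A b ∅ := fun k hk => by simp at hk

theorem le_rank_iff {l : ℕ} :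
    l ≤ rank cl A b ↔ ∃ s : Finset (Fin n), l ≤ s.card ∧ IsIndependent cl A b s := by
  have hb : BddAbove {k | ∃ s : Finset (Fin n), s.card = k ∧ IsIndependent cl A b s} :=
    ⟨n, by rintro k ⟨s, rfl, -⟩; simpa using s.card_le_univ⟩
  constructor
  · intro h
    obtain ⟨s, hs, hs'⟩ := Nat.sSup_mem (s := {k | ∃ s : Finset (Fin n), s.card = k ∧
      IsIndependent cl A b s}) ⟨0, ∅, rfl, isIndependent_empty⟩ hb
    exact ⟨s, hs ▸ h, hs'⟩
  · rintro ⟨s, hl, hs⟩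
    exact hl.trans (le_csSup hb ⟨s, rfl, hs⟩)

theorem rank_le : rank cl A b ≤ n := by
  obtain ⟨s, hl, -⟩ := le_rank_iff.1 (le_refl (rank cl A b))
  exact hl.trans (by simpa using s.card_le_univ)

theorem isIndependent_map {m : ℕ} (f : Fin m ↪ Fin n) (s : Finset (Fin m)) :
    IsIndependent cl A b (s.map f) ↔ IsIndependent cl A (b ∘ f) s := by
  have : ∀ k, b '' {l | l ∈ s.map f ∧ l ≠ f k} = (b ∘ f) '' {l | l ∈ s ∧ l ≠ k} := by
    intro k
    ext y
    simp only [mem_image, mem_ofPred_eq, Finset.mem_map, Function.comp_apply]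
    constructor
    · rintro ⟨_, ⟨⟨l, hl, rfl⟩, hne⟩, rfl⟩
      exact ⟨l, ⟨hl, fun h => hne (by rw [h])⟩, rfl⟩
    · rintro ⟨l, ⟨hl, hne⟩, rfl⟩
      exact ⟨f l, ⟨⟨l, hl, rfl⟩, fun h => hne (f.injective h)⟩, rfl⟩
  constructor
  · intro h k hk
    rw [← this]
    exact h (f k) (Finset.mem_map_of_mem f hk)
  · intro h k hk
    obtain ⟨k, hk', rfl⟩ := Finset.mem_map.1 hk
    rw [this]
    exact h k hk'

theorem rank_comp_perm (σ : Equiv.Perm (Fin n)) : rank cl A (b ∘ σ) = rank cl A b := by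
  refine eq_of_forall_le_iff fun l => ?_
  rw [le_rank_iff, le_rank_iff]
  constructor
  · rintro ⟨s, hl, hs⟩
    exact ⟨s.map σ.toEmbedding, by simpa using hl, (isIndependent_map _ _).2 hs⟩
  · rintro ⟨s, hl, hs⟩
    refine ⟨s.map σ.symm.toEmbedding, by simpa using hl, (isIndependent_map _ _).2 ?_⟩
    simpa [Function.comp_assoc] using hs

theorem le_dimOver_iff {V : Set (Fin n → M)} {l : ℕ} :
    (l : WithBot ℕ) ≤ dimOver cl A V ↔ ∃ b ∈ V, l ≤ rank cl A b := by
  unfold dimOver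
  split_ifs with h
  · simp [h]
  · rw [Nat.cast_le]
    have hb : BddAbove {k | ∃ b ∈ V, k = rank cl A b} :=
      ⟨n, by rintro k ⟨b, -, rfl⟩; exact rank_le⟩
    constructor
    · intro hl
      obtain ⟨b, hb, hb'⟩ := Nat.sSup_mem (s := {k | ∃ b ∈ V, k = rank cl A b})
        (by obtain ⟨b, hb⟩ := nonempty_iff_ne_empty.2 h; exact ⟨_, b, hb, rfl⟩) hb
      exact ⟨b, hb, hb' ▸ hl⟩
    · rintro ⟨b, hbV, hl⟩
      exact hl.trans (le_csSup hb ⟨b, hbV, rfl⟩)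

end Rank

section Closure

variable {L : FirstOrder.Language.{u, v}} {M : Type x} [L.Structure M] {κ : Cardinal.{x}}
  {cl : Set M → Set M} {A B : Set M} {n : ℕ}

namespace IsExistentialMatroid

variable (h : IsExistentialMatroid L κ cl)

include h

theorem cl_le {X Y : Set M} (hXY : X ⊆ cl Y) : cl X ⊆ cl Y :=
  (h.monotone _ _ hXY).trans (h.idempotent Y).subset

/-- If some `b k` became dependent once `b j` is added, exchange would put `b j` in the closure of
`A` and the old subtuple. -/
theorem indep_insert {b : Fin n → M} {s : Finset (Fin n)} (hs : IsIndependent cl A b s) {j : Fin n}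
    (hj : b j ∉ cl (A ∪ b '' s)) : IsIndependent cl A b (insert j s) := by
  have hjs : j ∉ s := fun hjs => hj (h.extension _ (Or.inr ⟨j, hjs, rfl⟩))
  intro k hk hk'
  rcases Finset.mem_insert.1 hk with rfl | hks
  · refine hj (h.monotone _ _ (union_subset_union_right A (image_mono ?_)) hk')
    rintro l ⟨hl, hlk⟩
    exact (Finset.mem_insert.1 hl).resolve_left hlk
  · have h1 : b k ∈ cl (insert (b j) (A ∪ b '' {l | l ∈ s ∧ l ≠ k})) := by
      refine h.monotone _ _ ?_ hk'
      rintro y (hy | ⟨l, ⟨hl, hlk⟩, rfl⟩)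
      · exact Or.inr (Or.inl hy)
      · rcases Finset.mem_insert.1 hl with rfl | hl
        · exact Or.inl rfl
        · exact Or.inr (Or.inr ⟨l, ⟨hl, hlk⟩, rfl⟩)
    refine hj (h.monotone _ _ ?_ (h.exchange _ _ _ h1 (hs k hks)))
    rintro y (rfl | hy | ⟨l, ⟨hl, -⟩, rfl⟩)
    · exact Or.inr ⟨k, hks, rfl⟩
    · exact Or.inl hy
    · exact Or.inr ⟨l, hl, rfl⟩

theorem indep_subset {b : Fin n → M} {s t : Finset (Fin n)} (ht : IsIndependent cl A b t)
    (hst : s ⊆ t) : IsIndependent cl A b s := fun k hk hk' =>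
  ht k (hst hk) (h.monotone _ _ (union_subset_union_right A (image_mono
    fun l (hl : l ∈ s ∧ l ≠ k) => (⟨hst hl.1, hl.2⟩ : l ∈ t ∧ l ≠ k))) hk')

theorem rank_anti {b : Fin n → M} (hAB : A ⊆ B) : rank cl B b ≤ rank cl A b := by
  obtain ⟨s, hl, hs⟩ := le_rank_iff.1 (le_refl (rank cl B b))
  exact le_rank_iff.2 ⟨s, hl, fun k hk hk' =>
    hs k hk (h.monotone _ _ (union_subset_union_left _ hAB) hk')⟩

-- An independent subtuple contains the last index at most once. If it does and `c` depends on `A`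
-- and `t`, the rest of the subtuple cannot span `t`, so some `t j` can take the place of `c`.
open Classical in
theorem rank_snoc (t : Fin n → M) (c : M) :
    rank cl A (Fin.snoc (α := fun _ => M) t c : Fin (n + 1) → M) =
      rank cl A t + if c ∈ cl (A ∪ range t) then 0 else 1 := by
  set b : Fin (n + 1) → M := Fin.snoc (α := fun _ => M) t c with hb
  have hbt : b ∘ Fin.castSuccEmb = t := by ext k; simp [hb]
  have him : ∀ s : Finset (Fin n), b '' (s.map Fin.castSuccEmb : Finset (Fin (n + 1))) = t '' s := by
    intro s
    rw [Finset.coe_map, ← image_comp, hbt]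
  have hlast : ∀ s : Finset (Fin n), Fin.last n ∉ s.map Fin.castSuccEmb := by
    intro s hs
    obtain ⟨k, -, hk⟩ := Finset.mem_map.1 hs
    exact (Fin.castSucc_lt_last k).ne hk
  apply le_antisymm
  · obtain ⟨s, hl, hs⟩ := le_rank_iff.1 (le_refl (rank cl A b))
    have hmap : ∃ s' : Finset (Fin n), s.erase (Fin.last n) = s'.map Fin.castSuccEmb := by
      refine ⟨Finset.univ.filter fun k => k.castSucc ∈ s, ?_⟩
      ext k
      induction k using Fin.lastCases with
      | last => simp [Fin.castSucc_ne_last]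
      | cast k => simp [Fin.castSucc_ne_last]
    obtain ⟨s', hs'⟩ := hmap
    have hind : IsIndependent cl A t s' := by
      rw [← hbt, ← isIndependent_map, ← hs']
      exact h.indep_subset hs (Finset.erase_subset _ _)
    have hcard : s'.card ≤ rank cl A t := le_rank_iff.2 ⟨s', le_rfl, hind⟩
    have hcard' : (s.erase (Fin.last n)).card = s'.card := by rw [hs', Finset.card_map]
    by_cases hls : Fin.last n ∈ s
    · have hscard := Finset.card_erase_add_one hls
      split_ifs with hc
      · have hc' : c ∉ cl (A ∪ t '' s') := by
          have := hs _ hls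
          rw [hb, Fin.snoc_last, ← hb] at this
          convert this using 4
          rw [← him, ← hs']
          congr 1
          ext l
          simp [and_comm]
        have hj : ∃ j, t j ∉ cl (A ∪ t '' s') := by
          by_contra! hall
          refine hc' (h.cl_le (union_subset ?_ ?_) hc)
          · exact subset_union_left.trans (h.extension _)
          · rintro _ ⟨j, rfl⟩
            exact hall j
        obtain ⟨j, hj⟩ := hj
        have hjs : j ∉ s' := fun hjs => hj (h.extension _ (Or.inr ⟨j, hjs, rfl⟩))
        have : s'.card + 1 ≤ rank cl A t := le_rank_iff.2
          ⟨insert j s', (Finset.card_insert_of_notMem hjs).ge, h.indep_insert hind hj⟩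
        omega
      · omega
    · rw [Finset.erase_eq_of_notMem hls] at hcard'
      omega
  · obtain ⟨s, hl, hs⟩ := le_rank_iff.1 (le_refl (rank cl A t))
    have hs' : IsIndependent cl A b (s.map Fin.castSuccEmb) := by
      rwa [isIndependent_map, hbt]
    split_ifs with hc
    · exact le_rank_iff.2 ⟨_, by simpa using hl, hs'⟩
    · refine le_rank_iff.2 ⟨insert (Fin.last n) (s.map Fin.castSuccEmb), ?_, h.indep_insert hs' ?_⟩
      · rw [Finset.card_insert_of_notMem (hlast s), Finset.card_map]
        omega
      · rw [him, hb, Fin.snoc_last]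
        exact fun hc' => hc (h.monotone _ _
          (union_subset_union_right A (image_subset_range t s)) hc')

theorem rank_one_le_iff {b : Fin 1 → M} : 1 ≤ rank cl A b ↔ b 0 ∉ cl A := by
  classical
  have hb : b = Fin.snoc (α := fun _ => M) (Fin.elim0 : Fin 0 → M) (b 0) := by
    ext k
    rw [Subsingleton.elim k (Fin.last 0), Fin.snoc_last]
    rfl
  have h0 : rank cl A (Fin.elim0 : Fin 0 → M) = 0 := Nat.le_zero.1 rank_le
  rw [hb, h.rank_snoc, h0, ← hb, Set.range_eq_empty, union_empty]
  split_ifs with hc <;> simp [hc]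

theorem equiv_mem_cl (σ : M ≃[L] M) {a : M} (ha : a ∈ cl A) : σ a ∈ cl (σ '' A) := by
  obtain ⟨m, φ, b, hφ, hb, hab⟩ := (h.definable A a).1 ha
  exact (h.definable _ _).2 ⟨m, φ, σ ∘ b, hφ, fun k => ⟨_, hb k, rfl⟩,
    (equiv_comp_mem_fiber σ φ b fun _ => a).2 hab⟩

theorem equiv_mem_cl_iff (σ : M ≃[L] M) {a : M} : σ a ∈ cl (σ '' A) ↔ a ∈ cl A := by
  refine ⟨fun ha => ?_, h.equiv_mem_cl σ⟩
  have := h.equiv_mem_cl σ.symm ha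
  rwa [σ.symm_apply_apply, ← image_comp, show (σ.symm : M → M) ∘ σ = id from
    funext σ.symm_apply_apply, image_id] at this

end IsExistentialMatroid

theorem SameType.definable {a a' : M} (hT : SameType L B a a') {X : Set (Fin 1 → M)}
    (hX : B.Definable L X) : (fun _ => a) ∈ X ↔ (fun _ => a') ∈ X := by
  obtain ⟨m, φ, b, hb, rfl⟩ := definable_iff_fiber.1 hX
  exact hT m φ b hb

/-- The formula `x = y`. -/
def eqFormula : L.Formula (Fin 1 ⊕ Fin 1) := (Term.var (Sum.inl 0)).equal (Term.var (Sum.inr 0))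

theorem fiber_eqFormula (b : Fin 1 → M) : fiber (eqFormula (L := L)) b = {fun _ => b 0} := by
  ext t
  rw [mem_fiber, eqFormula, Formula.realize_equal, mem_singleton_iff]
  exact ⟨fun h => funext fun k => by rw [Subsingleton.elim k 0]; exact h, fun h => by rw [h]; rfl⟩

theorem definable_singleton {a : M} (ha : a ∈ A) : A.Definable L {fun _ : Fin 1 => a} := by
  rw [← fiber_eqFormula (L := L) fun _ => a]
  exact definable_fiber _ fun _ => ha

theorem SameType.eq_of_mem {a a' : M} (hT : SameType L B a a') (ha : a ∈ B) : a' = a := by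
  have := (hT.definable (definable_singleton ha)).1 rfl
  exact congrFun this 0

namespace IsMonster

variable (hM : IsMonster L κ M)

include hM

theorem aleph0_lt : ℵ₀ < κ := by
  have := (Cardinal.lift_le.2 (le_max_left ℵ₀ L.card)).trans_lt hM.card_lt
  simpa using this

theorem lt_of_finite (hA : A.Finite) : #A < κ := (Cardinal.lt_aleph0_iff_set_finite.2 hA).trans
  hM.aleph0_lt

theorem union_lt (hA : #A < κ) (hB : #B < κ) : #(A ∪ B : Set M) < κ :=
  (Cardinal.mk_union_le _ _).trans_lt (Cardinal.add_lt_of_lt hM.aleph0_lt.le hA hB)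

/-- Elements with the same type over a finite set are conjugate over it. -/
theorem exists_equiv (hB : B.Finite) {a a' : M} (hT : SameType L B a a') :
    ∃ σ : M ≃[L] M, (∀ x ∈ B, σ x = x) ∧ σ a = a' := by
  classical
  have := hB.to_subtype
  let e := Finite.equivFin B
  let f : (insert a B : Set M).Elem → M := fun x => if (x : M) = a then a' else x
  obtain ⟨σ, hσ⟩ := hM.homogeneous (insert a B) (hM.lt_of_finite (hB.insert a)) f (by
    intro φ
    -- The elements of `B` become parameters and `a` becomes the variable, so that equality of types
    -- applies to `φ`. If `a ∈ B` it is still treated as the variable, which is harmless since then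
    -- `a' = a`.
    let g : (insert a B : Set M).Elem → Fin 1 ⊕ Fin (Nat.card B) := fun x =>
      if hx : (x : M) = a then Sum.inl 0 else Sum.inr (e ⟨x, x.2.resolve_left hx⟩)
    have hg : ∀ c : M, Sum.elim (fun _ => c) (fun k => (e.symm k : M)) ∘ g =
        fun x : (insert a B : Set M) => if (x : M) = a then c else x := by
      intro c
      ext x
      by_cases hx : (x : M) = a
      · simp [g, hx]
      · simp only [Function.comp_apply, g, hx, dite_false, ite_false, Sum.elim_inr]
        exact congrArg Subtype.val (e.symm_apply_apply _)
    have := hT _ (φ.relabel g) (fun k => e.symm k) fun k => (e.symm k).2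
    rw [mem_fiber_relabel, mem_fiber_relabel, hg, hg] at this
    have hid : (fun x : (insert a B : Set M) => if (x : M) = a then a else (x : M)) =
        Subtype.val := by
      ext x
      split_ifs with hx
      · exact hx.symm
      · rfl
    rwa [hid] at this)
  refine ⟨σ, fun x hx => ?_, ?_⟩
  · rw [hσ ⟨x, Or.inr hx⟩]
    by_cases hxa : x = a
    · subst hxa
      simpa [f] using hT.eq_of_mem hx
    · simp [f, hxa]
  · rw [hσ ⟨a, Or.inl rfl⟩]
    simp [f]

end IsMonster

namespace IsExistentialMatroid

variable (h : IsExistentialMatroid L κ cl) (hM : IsMonster L κ M)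

include h hM

/-- Every tuple is conjugate over `A` to a tuple whose rank does not drop over `A ∪ B`. -/
theorem exists_generic_tuple (hA : A.Finite) (hB : B.Finite) (b : Fin n → M) :
    ∃ σ : M ≃[L] M, (∀ x ∈ A, σ x = x) ∧ rank cl (A ∪ B) (σ ∘ b) = rank cl A b := by
  classical
  induction n with
  | zero => exact ⟨Language.Equiv.refl L M, fun _ _ => rfl,
      (Nat.le_zero.1 rank_le).trans (Nat.le_zero.1 rank_le).symm⟩
  | succ n ih =>
    obtain ⟨σ, hσA, hσ⟩ := ih (Fin.init b)
    set t := Fin.init (α := fun _ => M) b with ht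
    set c := b (Fin.last n) with hc
    have hb : b = Fin.snoc (α := fun _ => M) t c := (Fin.snoc_init_self b).symm
    have hσb : ∀ τ : M ≃[L] M, τ ∘ b = Fin.snoc (α := fun _ => M) (τ ∘ t) (τ c) := by
      intro τ
      rw [hb, Fin.comp_snoc]
    have himg : ∀ τ : M ≃[L] M, (∀ x ∈ A, τ x = x) →
        τ '' (A ∪ range t) = A ∪ range (τ ∘ t) := by
      intro τ hτ
      rw [image_union, range_comp]
      congr 1
      exact (image_congr hτ).trans (image_id' A)
    by_cases hct : c ∈ cl (A ∪ range t)
    · refine ⟨σ, hσA, ?_⟩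
      have hσc := h.equiv_mem_cl σ hct
      rw [himg σ hσA] at hσc
      rw [hσb, h.rank_snoc, hσ, hb, h.rank_snoc, if_pos hct, if_pos]
      exact h.monotone _ _ (union_subset_union_left _ subset_union_left) hσc
    · have hσc : σ c ∉ cl (A ∪ range (σ ∘ t)) := by
        rwa [← himg σ hσA, h.equiv_mem_cl_iff σ]
      have hfin : (A ∪ range (σ ∘ t)).Finite := hA.union (finite_range _)
      -- The base contains `σ ∘ t`, so the automorphism `τ` that moves `σ c` to `c'` does not
      -- disturb the coordinates already placed.
      obtain ⟨c', hT, hc'⟩ := h.existence (σ c) _ B (hM.lt_of_finite hfin) (hM.lt_of_finite hB) hσc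
      obtain ⟨τ, hτ, hτc⟩ := hM.exists_equiv hfin hT
      have hτt : (τ.comp σ) ∘ t = σ ∘ t := funext fun k => hτ _ (Or.inr ⟨k, rfl⟩)
      have hτA : ∀ x ∈ A, (τ.comp σ) x = x := fun x hx => by
        rw [Language.Equiv.comp_apply, hσA x hx, hτ x (Or.inl hx)]
      refine ⟨τ.comp σ, hτA, ?_⟩
      rw [hσb, h.rank_snoc, hτt, hσ, hb, h.rank_snoc, if_neg hct, if_neg]
      rw [Language.Equiv.comp_apply, hτc]
      rwa [union_right_comm] at hc'

/-- `V` is invariant under the automorphisms fixing `A`, so it contains the conjugate of `b` whose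
rank does not drop over `A ∪ B`. -/
theorem dimOver_union (hA : A.Finite) (hB : B.Finite) {V : Set (Fin n → M)}
    (hV : A.Definable L V) : dimOver cl (A ∪ B) V = dimOver cl A V := by
  refine withBot_ext fun l => ?_
  rw [le_dimOver_iff, le_dimOver_iff]
  constructor
  · rintro ⟨b, hb, hl⟩
    exact ⟨b, hb, hl.trans (h.rank_anti subset_union_left)⟩
  · rintro ⟨b, hb, hl⟩
    obtain ⟨σ, hσA, hσ⟩ := h.exists_generic_tuple hM hA hB b
    exact ⟨σ ∘ b, (equiv_comp_mem_iff hV σ hσA b).2 hb, by rwa [hσ]⟩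

/-- The chosen parameter set and `A` are both compared with their union. -/
theorem dim_eq_dimOver (hA : A.Finite) {V : Set (Fin n → M)} (hV : A.Definable L V) :
    dim L cl V = dimOver cl A V := by
  have hex : ∃ A : Set M, A.Finite ∧ A.Definable L V := ⟨A, hA, hV⟩
  rw [dim, dif_pos hex, ← h.dimOver_union hM hex.choose_spec.1 hA hex.choose_spec.2, union_comm,
    h.dimOver_union hM hA hex.choose_spec.1 hV]

theorem le_dim_iff (hA : A.Finite) {V : Set (Fin n → M)} (hV : A.Definable L V) {l : ℕ} :
    (l : WithBot ℕ) ≤ dim L cl V ↔ ∃ b ∈ V, l ≤ rank cl A b := by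
  rw [h.dim_eq_dimOver hM hA hV, le_dimOver_iff]

end IsExistentialMatroid

end Closure

/-! ### Auxiliary formulas and arithmetic with the value `-∞`. -/

section Formulas

variable {L : FirstOrder.Language.{u, v}} {M : Type x} [L.Structure M]

/-- Some of the parameters of a formula become variables. -/
def splitFormula {m p : ℕ} (ψ : L.Formula (Fin (m + p))) : L.Formula (Fin m ⊕ Fin p) :=
  ψ.relabel finSumFinEquiv.symm

theorem mem_fiber_splitFormula {m p : ℕ} {ψ : L.Formula (Fin (m + p))} {t : Fin m → M}
    {b : Fin p → M} : t ∈ fiber (splitFormula ψ) b ↔ ψ.Realize (Fin.append t b) := by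
  rw [splitFormula, mem_fiber_relabel, iff_iff_eq]
  congr 1
  ext k
  induction k using Fin.addCases <;> simp

/-- The formula expressing that a fibre is nonempty. -/
noncomputable def nonemptyFiber {n m : ℕ} (φ : L.Formula (Fin n ⊕ Fin m)) : L.Formula (Fin m) :=
  Formula.iExs (Fin n) (φ.relabel Sum.swap)

theorem realize_nonemptyFiber {n m : ℕ} {φ : L.Formula (Fin n ⊕ Fin m)} {b : Fin m → M} :
    (nonemptyFiber φ).Realize b ↔ (fiber φ b).Nonempty := by
  rw [nonemptyFiber, Formula.realize_iExs]
  refine exists_congr fun a => ?_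
  rw [Formula.realize_relabel, mem_fiber, Sum.elim_swap]

theorem withBot_le {x y : WithBot ℕ} (h : ∀ l : ℕ, (l : WithBot ℕ) ≤ x → (l : WithBot ℕ) ≤ y) :
    x ≤ y := by
  induction x with
  | bot => exact bot_le
  | coe x => exact h x le_rfl

theorem withBot_cases {x : WithBot ℕ} {n : ℕ} (h : x ≤ n) : x = ⊥ ∨ ∃ l : ℕ, l ≤ n ∧ x = l := by
  induction x with
  | bot => exact Or.inl rfl
  | coe x => exact Or.inr ⟨x, WithBot.coe_le_coe.1 h, rfl⟩

theorem withBot_eq_iff {x : WithBot ℕ} {l : ℕ} :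
    x = l ↔ (l : WithBot ℕ) ≤ x ∧ ¬ ((l + 1 : ℕ) : WithBot ℕ) ≤ x := by
  induction x with
  | bot =>
    refine iff_of_false (by simp) fun h => ?_
    simp at h
  | coe x =>
    change ((x : ℕ) : WithBot ℕ) = l ↔ (l : WithBot ℕ) ≤ (x : ℕ) ∧ ¬ ((l + 1 : ℕ) : WithBot ℕ) ≤ (x : ℕ)
    rw [Nat.cast_le, Nat.cast_le, Nat.cast_inj]
    omega

theorem withBot_eq_bot_iff {x : WithBot ℕ} : x = ⊥ ↔ ¬ ((0 : ℕ) : WithBot ℕ) ≤ x := by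
  induction x with
  | bot => simp
  | coe x =>
    refine iff_of_false (by simp) (not_not.2 ?_)
    change ((0 : ℕ) : WithBot ℕ) ≤ (x : ℕ)
    simp

theorem preimage_init_definable {m : ℕ} {A : Set M} {V : Set (Fin m → M)} (hV : A.Definable L V) :
    A.Definable L {t : Fin (m + 1) → M | Fin.init t ∈ V} :=
  hV.preimage_comp (Fin.castSucc : Fin m → Fin (m + 1))

end Formulas

/-! ### From an existential matroid to a dimension function. -/

namespace IsExistentialMatroid

section

variable {L : FirstOrder.Language.{u, v}} {M : Type x} [L.Structure M] {κ : Cardinal.{x}}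
  {cl : Set M → Set M} {A : Set M} {n : ℕ} (h : IsExistentialMatroid L κ cl)

include h

open Classical in
theorem rank_one {b : Fin 1 → M} : rank cl A b = if b 0 ∈ cl A then 0 else 1 := by
  have hle : rank cl A b ≤ 1 := rank_le
  have := h.rank_one_le_iff (A := A) (b := b)
  split_ifs with hb
  · have : ¬ 1 ≤ rank cl A b := fun h1 => this.1 h1 hb
    omega
  · have := this.2 hb
    omega

variable (hM : IsMonster L κ M)

include hM

theorem dim_le {V : Set (Fin n → M)} (hV : univ.Definable L V) : dim L cl V ≤ n := by
  obtain ⟨A, -, hA, hV⟩ := exists_finite_definable hV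
  refine withBot_le fun l hl => ?_
  obtain ⟨b, -, hb⟩ := (h.le_dim_iff hM hA hV).1 hl
  exact Nat.cast_le.2 (hb.trans rank_le)

theorem zero_le_dim_iff {V : Set (Fin n → M)} (hV : univ.Definable L V) :
    ((0 : ℕ) : WithBot ℕ) ≤ dim L cl V ↔ V.Nonempty := by
  obtain ⟨A, -, hA, hV⟩ := exists_finite_definable hV
  rw [h.le_dim_iff hM hA hV]
  exact exists_congr fun b => by simp

theorem dim_eq_bot_iff {V : Set (Fin n → M)} (hV : univ.Definable L V) :
    dim L cl V = ⊥ ↔ V = ∅ := by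
  rw [withBot_eq_bot_iff, h.zero_le_dim_iff hM hV, not_nonempty_iff_eq_empty]

theorem one_le_dim_iff (hA : A.Finite) {V : Set (Fin 1 → M)} (hV : A.Definable L V) :
    ((1 : ℕ) : WithBot ℕ) ≤ dim L cl V ↔ ∃ c, (fun _ => c) ∈ V ∧ c ∉ cl A := by
  rw [h.le_dim_iff hM hA hV]
  simp only [h.rank_one_le_iff]
  constructor
  · rintro ⟨b, hb, hb'⟩
    refine ⟨b 0, ?_, hb'⟩
    convert hb using 2
    exact congrArg b (Subsingleton.elim _ _)
  · rintro ⟨c, hc, hc'⟩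
    exact ⟨_, hc, hc'⟩

theorem dim_eq_one_iff (hA : A.Finite) {V : Set (Fin 1 → M)} (hV : A.Definable L V) :
    dim L cl V = (1 : ℕ) ↔ ∃ c, (fun _ => c) ∈ V ∧ c ∉ cl A := by
  rw [← h.one_le_dim_iff hM hA hV]
  exact ⟨fun h => h.ge, fun h' => le_antisymm (h.dim_le hM (hV.mono (subset_univ _))) h'⟩

theorem mem_cl_of_dim_eq_zero (hA : A.Finite) {V : Set (Fin 1 → M)} (hV : A.Definable L V)
    (hd : dim L cl V = (0 : ℕ)) {c : M} (hc : (fun _ => c) ∈ V) : c ∈ cl A := by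
  by_contra hc'
  have := (h.dim_eq_one_iff hM hA hV).2 ⟨c, hc, hc'⟩
  rw [hd, Nat.cast_inj] at this
  omega

theorem dim_union {S T : Set (Fin n → M)} (hS : univ.Definable L S) (hT : univ.Definable L T) :
    dim L cl (S ∪ T) = max (dim L cl S) (dim L cl T) := by
  obtain ⟨A, -, hA, hS⟩ := exists_finite_definable hS
  obtain ⟨B, -, hB, hT⟩ := exists_finite_definable hT
  have hS' := hS.mono (subset_union_left (t := B))
  have hT' := hT.mono (subset_union_right (s := A))
  refine withBot_ext fun l => ?_
  rw [le_max_iff, h.le_dim_iff hM (hA.union hB) hS', h.le_dim_iff hM (hA.union hB) hT',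
    h.le_dim_iff hM (hA.union hB) (hS'.union hT')]
  simp only [mem_union, or_and_right, exists_or]

theorem dim_perm {S : Set (Fin n → M)} (hS : univ.Definable L S) (σ : Equiv.Perm (Fin n)) :
    dim L cl ((fun t => t ∘ σ) '' S) = dim L cl S := by
  obtain ⟨A, -, hA, hS⟩ := exists_finite_definable hS
  have hS' : A.Definable L ((fun t => t ∘ σ) '' S) := hS.image_comp σ
  refine withBot_ext fun l => ?_
  rw [h.le_dim_iff hM hA hS, h.le_dim_iff hM hA hS', exists_mem_image]
  simp only [rank_comp_perm]

/-- Additivity of the dimension. -/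
theorem dim_fiber_add {m : ℕ} {U : Set (Fin (m + 1) → M)} (hU : univ.Definable L U)
    {V : Set (Fin m → M)} (hV : univ.Definable L V) {i : ℕ}
    (hi : ∀ t ∈ V, dim L cl (lastFiber U t) = i) :
    dim L cl (U ∩ {t | Fin.init t ∈ V}) = dim L cl V + i := by
  classical
  obtain ⟨A, -, hA, hU⟩ := exists_finite_definable hU
  obtain ⟨B, -, hB, hV⟩ := exists_finite_definable hV
  replace hU := hU.mono (subset_union_left (t := B))
  replace hV := hV.mono (subset_union_right (s := A))
  replace hA := hA.union hB
  set A := A ∪ B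
  have hUV : A.Definable L (U ∩ {t | Fin.init t ∈ V}) := hU.inter (preimage_init_definable hV)
  -- The fibre over `t` is defined over `A ∪ range t`, so its dimension is tested by the closure
  -- that occurs in `rank_snoc`. Both inequalities then reduce to that formula.
  have hfib : ∀ (t : Fin m → M) (l : ℕ), (l : WithBot ℕ) ≤ dim L cl (lastFiber U t) ↔
      ∃ c : Fin 1 → M, Fin.snoc (α := fun _ => M) t (c 0) ∈ U ∧
        l ≤ if c 0 ∈ cl (A ∪ range t) then 0 else 1 := by
    intro t l
    rw [h.le_dim_iff hM (hA.union (finite_range t)) (definable_lastFiber hU t)]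
    simp only [h.rank_one]
    rfl
  refine withBot_ext fun l => ?_
  rw [h.le_dim_iff hM hA hUV]
  constructor
  · rintro ⟨b, ⟨hbU, hbV⟩, hl⟩
    have hb : b = Fin.snoc (α := fun _ => M) (Fin.init b) (b (Fin.last m)) :=
      (Fin.snoc_init_self b).symm
    set t := Fin.init (α := fun _ => M) b
    rw [hb, h.rank_snoc] at hl
    have h1 := (hfib t _).2 ⟨fun _ => b (Fin.last m), by rwa [← hb], le_rfl⟩
    rw [hi t hbV, Nat.cast_le] at h1
    beta_reduce at h1
    have h2 := (h.le_dim_iff hM hA hV).2 ⟨t, hbV, le_rfl⟩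
    calc (l : WithBot ℕ) ≤ ((rank cl A t + i : ℕ) : WithBot ℕ) := Nat.cast_le.2 (by omega)
      _ = (rank cl A t : WithBot ℕ) + i := by push_cast; rfl
      _ ≤ _ := by gcongr
  · intro hl
    rcases withBot_cases (h.dim_le hM (hV.mono (subset_univ _))) with hd | ⟨r, -, hd⟩
    · rw [hd] at hl; simp at hl
    · rw [hd] at hl
      norm_cast at hl
      -- A point of maximal rank in `V`, completed by a point of its fibre that attains the
      -- dimension of the fibre over `A` and `t`.
      obtain ⟨t, ht, hr⟩ := (h.le_dim_iff hM hA hV).1 hd.ge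
      obtain ⟨c, hc, hic⟩ := (hfib t i).1 (hi t ht).ge
      refine ⟨_, ⟨hc, ?_⟩, ?_⟩
      · rwa [mem_ofPred_eq, Fin.init_snoc]
      · rw [h.rank_snoc]
        omega

theorem dim_univ : dim L cl (univ : Set (Fin 1 → M)) = (1 : ℕ) := by
  rw [h.dim_eq_one_iff hM finite_empty definable_univ]
  obtain ⟨X, hX⟩ := h.nontrivial
  obtain ⟨c, hc⟩ := (ne_univ_iff_exists_notMem (cl X)).1 hX
  exact ⟨c, mem_univ _, fun hc' => hc (h.monotone _ _ (empty_subset _) hc')⟩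

theorem dim_singleton (a : M) : dim L cl {fun _ : Fin 1 => a} = (0 : ℕ) := by
  have hd : ({a} : Set M).Definable L {fun _ : Fin 1 => a} := definable_singleton rfl
  rw [withBot_eq_iff, h.zero_le_dim_iff hM (hd.mono (subset_univ _)),
    h.one_le_dim_iff hM (finite_singleton a) hd]
  refine ⟨singleton_nonempty _, ?_⟩
  rintro ⟨c, hc, hc'⟩
  exact hc' (h.extension _ (congrFun hc 0))

/-- The dimension is a dimension function if it is definable for subsets of the line. -/
theorem isDimensionFunction
    (hd : ∀ (m : ℕ) (φ : L.Formula (Fin 1 ⊕ Fin m)) (i : ℕ), i ≤ 1 →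
      ∃ ψ : L.Formula (Fin m), ∀ b : Fin m → M, dim L cl (fiber φ b) = i ↔ ψ.Realize b) :
    IsDimensionFunction L fun n (V : Set (Fin n → M)) => dim L cl V := by
  have hdef : ∀ (m : ℕ) (A : Set M) (U : Set (Fin (m + 1) → M)), A.Definable L U →
      ∀ i : ℕ, i ≤ 1 → A.Definable L {t | dim L cl (lastFiber U t) = (i : WithBot ℕ)} := by
    intro m A U hU i hi
    obtain ⟨p, φ, b, hb, rfl⟩ := definable_iff_fiber.1 hU
    obtain ⟨ψ, hψ⟩ := hd _ (lastFormula φ) i hi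
    convert definable_fiber (splitFormula ψ) hb using 1
    ext t
    rw [mem_fiber_splitFormula, ← hψ, mem_ofPred_eq, lastFiber_fiber]
  exact
  { eq_bot_iff := fun m S hS => h.dim_eq_bot_iff hM hS
    singleton := h.dim_singleton hM
    line := h.dim_univ hM
    union := fun m S T hS hT => h.dim_union hM hS hT
    perm := fun m S σ hS => h.dim_perm hM hS σ
    fiber_definable := hdef
    fiber_add := fun m U hU i hi =>
      h.dim_fiber_add hM hU (hdef m _ U hU i hi) fun t ht => ht }

end

end IsExistentialMatroid

/-! ### Uniform definability reduces to subsets of the line. -/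

section Uniform

variable {L : FirstOrder.Language.{u, v}} {I : Type w} {M : I → Type y} [∀ i, L.Structure (M i)]
  {κ : I → Cardinal.{y}} {cl : ∀ i, Set (M i) → Set (M i)}

/-- Induction on the number of coordinates: a set has dimension at least `l + 1` iff the base points
with fibres of dimension zero have dimension at least `l + 1`, or those with fibres of dimension one
have dimension at least `l`. Lower bounds make this a disjunction. Dimension zero on the line needs
no formula of its own, being "nonempty and not of dimension one". -/
theorem exists_le_dim_formula (hM : ∀ i, IsMonster L (κ i) (M i))
    (h : ∀ i, IsExistentialMatroid L (κ i) (cl i))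
    (h1 : ∀ (m : ℕ) (φ : L.Formula (Fin 1 ⊕ Fin m)), ∃ ψ : L.Formula (Fin m),
      ∀ (i : I) (b : Fin m → M i), dim L (cl i) (fiber φ b) = (1 : ℕ) ↔ ψ.Realize b) :
    ∀ (n m : ℕ) (φ : L.Formula (Fin n ⊕ Fin m)) (l : ℕ), ∃ ψ : L.Formula (Fin m),
      ∀ (i : I) (b : Fin m → M i), (l : WithBot ℕ) ≤ dim L (cl i) (fiber φ b) ↔ ψ.Realize b := by
  have hdef : ∀ (n m : ℕ) (φ : L.Formula (Fin n ⊕ Fin m)) (i : I) (b : Fin m → M i),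
      univ.Definable L (fiber φ b) := fun n m φ i b => definable_fiber φ fun k => mem_univ (b k)
  intro n
  induction n with
  | zero =>
    rintro m φ (_ | l)
    · refine ⟨nonemptyFiber φ, fun i b => ?_⟩
      rw [realize_nonemptyFiber, (h i).zero_le_dim_iff (hM i) (hdef _ _ _ _ _)]
    · refine ⟨⊥, fun i b => ?_⟩
      rw [Formula.realize_bot, iff_false]
      intro hl
      have := hl.trans ((h i).dim_le (hM i) (hdef _ _ _ _ _))
      rw [Nat.cast_le] at this
      omega
  | succ n ih =>
    rintro m φ (_ | l)
    · refine ⟨nonemptyFiber φ, fun i b => ?_⟩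
      rw [realize_nonemptyFiber, (h i).zero_le_dim_iff (hM i) (hdef _ _ _ _ _)]
    · obtain ⟨χ, hχ⟩ := h1 _ (lastFormula φ)
      set φ₁ := splitFormula χ with hφ₁
      set φ₀ := splitFormula (nonemptyFiber (lastFormula φ) ⊓ χ.not) with hφ₀
      obtain ⟨ψ₀, hψ₀⟩ := ih m φ₀ (l + 1)
      obtain ⟨ψ₁, hψ₁⟩ := ih m φ₁ l
      refine ⟨ψ₀ ⊔ ψ₁, fun i b => ?_⟩
      rw [Formula.realize_sup, ← hψ₀, ← hψ₁]
      have hf₁ : ∀ t, t ∈ fiber φ₁ b ↔ dim L (cl i) (lastFiber (fiber φ b) t) = (1 : ℕ) := by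
        intro t
        rw [hφ₁, mem_fiber_splitFormula, ← hχ, lastFiber_fiber]
      have hf₀ : ∀ t, t ∈ fiber φ₀ b ↔ dim L (cl i) (lastFiber (fiber φ b) t) = (0 : ℕ) := by
        intro t
        rw [hφ₀, mem_fiber_splitFormula, Formula.realize_inf, realize_nonemptyFiber,
          Formula.realize_not, ← hχ, ← (h i).zero_le_dim_iff (hM i) (hdef _ _ _ _ _),
          lastFiber_fiber, withBot_eq_iff (l := 0)]
        refine and_congr_right fun _ => not_congr ⟨fun h' => h'.ge, fun h' => ?_⟩
        exact le_antisymm ((h i).dim_le (hM i) (hdef _ _ _ _ _)) h'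
      have hU : fiber φ b = (fiber φ b ∩ {t | Fin.init t ∈ fiber φ₀ b}) ∪
          (fiber φ b ∩ {t | Fin.init t ∈ fiber φ₁ b}) := by
        rw [← inter_union_distrib_left, eq_comm, inter_eq_left]
        intro t ht
        have hne : (lastFiber (fiber φ b) (Fin.init t)).Nonempty := by
          refine ⟨fun _ => t (Fin.last n), ?_⟩
          change Fin.snoc (α := fun _ => M i) (Fin.init t) (t (Fin.last n)) ∈ fiber φ b
          rwa [Fin.snoc_init_self]
        rw [lastFiber_fiber, ← (h i).zero_le_dim_iff (hM i) (hdef _ _ _ _ _)] at hne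
        change Fin.init t ∈ fiber φ₀ b ∨ Fin.init t ∈ fiber φ₁ b
        rw [hf₀, hf₁, lastFiber_fiber]
        rcases withBot_cases ((h i).dim_le (hM i) (hdef _ _ (lastFormula φ) i
          (Fin.append (Fin.init t) b))) with hd | ⟨r, hr, hd⟩
        · rw [hd] at hne; simp at hne
        · rw [hd, Nat.cast_inj, Nat.cast_inj]
          omega
      rw [hU, (h i).dim_union (hM i) ((hdef _ _ _ _ _).inter (preimage_init_definable
        (hdef _ _ _ _ _))) ((hdef _ _ _ _ _).inter (preimage_init_definable (hdef _ _ _ _ _))),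
        (h i).dim_fiber_add (hM i) (hdef _ _ _ _ _) (hdef _ _ _ _ _) fun t ht => (hf₀ t).1 ht,
        (h i).dim_fiber_add (hM i) (hdef _ _ _ _ _) (hdef _ _ _ _ _) fun t ht => (hf₁ t).1 ht,
        le_max_iff, Nat.cast_zero, add_zero]
      refine or_congr_right ?_
      generalize dim L (cl i) (fiber φ₁ b) = x
      induction x with
      | bot => simp
      | coe x =>
        change ((l + 1 : ℕ) : WithBot ℕ) ≤ ((x + 1 : ℕ) : WithBot ℕ) ↔
          (l : WithBot ℕ) ≤ (x : ℕ)
        rw [Nat.cast_le, Nat.cast_le]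
        omega

/-- The dimension is uniformly definable if it is so for subsets of the line. -/
theorem uniformlyDefinable_of_line (hM : ∀ i, IsMonster L (κ i) (M i))
    (h : ∀ i, IsExistentialMatroid L (κ i) (cl i))
    (h1 : ∀ (m : ℕ) (φ : L.Formula (Fin 1 ⊕ Fin m)), ∃ ψ : L.Formula (Fin m),
      ∀ (i : I) (b : Fin m → M i), dim L (cl i) (fiber φ b) = (1 : ℕ) ↔ ψ.Realize b) :
    UniformlyDefinable L cl := by
  intro n m φ l _
  obtain ⟨ψ, hψ⟩ := exists_le_dim_formula hM h h1 n m φ l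
  obtain ⟨ψ', hψ'⟩ := exists_le_dim_formula hM h h1 n m φ (l + 1)
  refine ⟨ψ ⊓ ψ'.not, fun i b => ?_⟩
  rw [Formula.realize_inf, Formula.realize_not, ← hψ, ← hψ', withBot_eq_iff]

end Uniform

/-! ### From a dimension function to an existential matroid. -/

section

variable {L : FirstOrder.Language.{u, v}} {N : Type x} [L.Structure N] {A : Set N}

/-- The parameter `c` is replaced by a first coordinate, which brings closure over `insert c A`
within reach of the fibre axiom for relations defined over `A`. -/
theorem exists_lastFiber_of_insert {c : N} {X : Set (Fin 1 → N)}
    (hX : (insert c A).Definable L X) :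
    ∃ U : Set (Fin 2 → N), A.Definable L U ∧ lastFiber U (fun _ => c) = X := by
  classical
  obtain ⟨m, φ, b, hb, rfl⟩ := definable_iff_fiber.1 hX
  let g : Fin 1 ⊕ Fin m → A ⊕ Fin 2 := Sum.elim (fun _ => Sum.inr 1)
    fun k => if hk : b k = c then Sum.inr 0 else Sum.inl ⟨b k, (hb k).resolve_left hk⟩
  refine ⟨{t | (φ.relabel g).Realize (Sum.elim (↑) t)},
    definable_iff_exists_formula_sum.2 ⟨_, rfl⟩, ?_⟩
  ext a
  change (φ.relabel g).Realize _ ↔ φ.Realize _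
  rw [Formula.realize_relabel, iff_iff_eq]
  congr 1
  ext k
  rcases k with k | k
  · simp only [g, Function.comp_apply, Sum.elim_inl, Sum.elim_inr]
    rw [Subsingleton.elim k 0]
    exact Fin.snoc_last (α := fun _ => N) _ _
  · by_cases hk : b k = c
    · simp only [g, Function.comp_apply, Sum.elim_inr, hk, dite_true]
      exact Fin.snoc_castSucc (α := fun _ => N) (a 0) (fun _ : Fin 1 => c) 0
    · simp [g, hk]

theorem mem_lastFiber_swap {W : Set (Fin 2 → N)} {a c : N} :
    (fun _ => c) ∈ lastFiber ((fun t => t ∘ Equiv.swap (0 : Fin 2) 1) '' W) (fun _ => a) ↔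
      (fun _ => a) ∈ lastFiber W (fun _ => c) := by
  have hsnoc : ∀ p q : N, Fin.snoc (α := fun _ => N) (fun _ : Fin 1 => p) q = ![p, q] := by
    intro p q
    ext k
    fin_cases k <;> rfl
  change Fin.snoc _ _ ∈ _ '' W ↔ Fin.snoc _ _ ∈ W
  rw [hsnoc, hsnoc]
  have hswap : ∀ p q : N, ![p, q] ∘ Equiv.swap (0 : Fin 2) 1 = ![q, p] := by
    intro p q
    ext k
    fin_cases k <;> rfl
  constructor
  · rintro ⟨t, ht, hta⟩
    convert ht using 1
    rw [← hswap, ← hta]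
    ext k
    simp
  · exact fun ht => ⟨_, ht, hswap _ _⟩

variable {d : ∀ n : ℕ, Set (Fin n → N) → WithBot ℕ}

namespace IsDimensionFunction

variable (hd : IsDimensionFunction L d)

include hd

theorem mono {m : ℕ} {S T : Set (Fin m → N)} (hS : univ.Definable L S) (hT : univ.Definable L T)
    (hST : S ⊆ T) : d m S ≤ d m T := by
  have := hd.union m S T hS hT
  rw [union_eq_self_of_subset_left hST] at this
  rw [this]
  exact le_max_left _ _

theorem le_one {X : Set (Fin 1 → N)} (hX : univ.Definable L X) : d 1 X ≤ (1 : ℕ) := by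
  rw [Nat.cast_one, ← hd.line]
  exact hd.mono hX definable_univ (subset_univ X)

theorem line_cases {X : Set (Fin 1 → N)} (hX : univ.Definable L X) (hne : X.Nonempty) :
    d 1 X = (0 : ℕ) ∨ d 1 X = (1 : ℕ) := by
  rcases withBot_cases (hd.le_one hX) with h | ⟨l, hl, h⟩
  · exact absurd ((hd.eq_bot_iff 1 X hX).1 h) hne.ne_empty
  · interval_cases l
    · exact Or.inl h
    · exact Or.inr h

/-- The axioms normalise only the line and its points. Projecting the line to the zeroth power gives
`1 = d 0 univ + 1`. -/
theorem point : d 0 univ = (0 : ℕ) := by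
  have h := hd.fiber_add 0 univ definable_univ 1 le_rfl
  have hset : {t : Fin 0 → N | d 1 (lastFiber univ t) = ((1 : ℕ) : WithBot ℕ)} = univ :=
    eq_univ_of_forall fun t => by
      have : lastFiber (univ : Set (Fin 1 → N)) t = univ := rfl
      rw [mem_ofPred_eq, this, hd.line, Nat.cast_one]
  have hset' : univ ∩ {t : Fin 1 → N | d 1 (lastFiber univ (Fin.init t)) = ((1 : ℕ) : WithBot ℕ)} =
      univ := by
    rw [univ_inter]
    exact eq_univ_of_forall fun t => (hset.symm ▸ mem_univ (Fin.init t) : Fin.init t ∈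
      {t : Fin 0 → N | d 1 (lastFiber univ t) = ((1 : ℕ) : WithBot ℕ)})
  rw [hset, hset', hd.line] at h
  generalize d 0 univ = y at h
  induction y with
  | bot => simp at h
  | coe y =>
    change ((1 : ℕ) : WithBot ℕ) = ((y + 1 : ℕ) : WithBot ℕ) at h
    rw [Nat.cast_inj] at h
    change ((y : ℕ) : WithBot ℕ) = _
    rw [Nat.cast_inj]
    omega

theorem mem_matroid {X : Set (Fin 1 → N)} (hX : A.Definable L X) (hdX : d 1 X ≤ (0 : ℕ)) {b : N}
    (hb : (fun _ => b) ∈ X) : b ∈ matroidOfDim L d A := by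
  refine ⟨X, hX, ?_, hb⟩
  rcases hd.line_cases (hX.mono (subset_univ A)) ⟨_, hb⟩ with h | h
  · rw [h, Nat.cast_zero]
  · rw [h, Nat.cast_le] at hdX
    omega

/-- The set of points whose fibre has dimension `i` has dimension at most `d U - i`. -/
theorem fiber_add_le {m : ℕ} {U : Set (Fin (m + 1) → N)} (hU : univ.Definable L U) {i : ℕ}
    (hi : i ≤ 1) : d m {t | d 1 (lastFiber U t) = (i : WithBot ℕ)} + i ≤ d (m + 1) U := by
  rw [← hd.fiber_add m U hU i hi]
  exact hd.mono (hU.inter (preimage_init_definable (hd.fiber_definable m _ U hU i hi))) hU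
    inter_subset_left

/-- A definable relation, restricted to its fibres of dimension zero, with the coordinates exchanged. -/
theorem exists_swap {U : Set (Fin 2 → N)} (hU : A.Definable L U) {a c : N}
    (hac : (fun _ => a) ∈ lastFiber U (fun _ => c)) (hc : d 1 (lastFiber U (fun _ => c)) = (0 : ℕ)) :
    ∃ W : Set (Fin 2 → N), A.Definable L W ∧ (fun _ => c) ∈ lastFiber W (fun _ => a) ∧
      d 2 W = d 1 {t | d 1 (lastFiber U t) = ((0 : ℕ) : WithBot ℕ)} := by
  have hV := hd.fiber_definable 1 A U hU 0 zero_le_one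
  have hW : A.Definable L (U ∩ {t | Fin.init t ∈
      {t : Fin 1 → N | d 1 (lastFiber U t) = ((0 : ℕ) : WithBot ℕ)}}) :=
    hU.inter (preimage_init_definable hV)
  refine ⟨_, hW.image_comp (Equiv.swap (0 : Fin 2) 1), mem_lastFiber_swap.2 ⟨hac, ?_⟩, ?_⟩
  · rw [mem_ofPred_eq, Fin.init_snoc]
    exact hc
  · rw [hd.perm 2 _ _ (hW.mono (subset_univ A))]
    have := hd.fiber_add 1 U (hU.mono (subset_univ A)) 0 zero_le_one
    rw [Nat.cast_zero, add_zero] at this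
    exact this

theorem matroid_extension : A ⊆ matroidOfDim L d A := fun a ha =>
  ⟨_, definable_singleton ha, hd.singleton a, rfl⟩

omit hd in
theorem _root_.ExistentialMatroid.matroidOfDim_mono {B : Set N} (hAB : A ⊆ B) :
    matroidOfDim L d A ⊆ matroidOfDim L d B :=
  fun _ ⟨X, hX, h⟩ => ⟨X, hX.mono hAB, h⟩

/-- `a` lies in the fibre over `c` of a relation whose base has dimension zero and whose relevant
fibres have dimension zero, so the relation itself has dimension zero. So does, by the other
projection, an `A`-definable set of first coordinates that contains `a`. -/
theorem matroid_insert {a c : N} (hc : c ∈ matroidOfDim L d A)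
    (ha : a ∈ matroidOfDim L d (insert c A)) : a ∈ matroidOfDim L d A := by
  obtain ⟨Z, hZ, hdZ, hcZ⟩ := hc
  obtain ⟨X, hX, hdX, haX⟩ := ha
  obtain ⟨U, hU, rfl⟩ := exists_lastFiber_of_insert hX
  set U' := U ∩ {t | Fin.init t ∈ Z} with hU'
  have hfib : ∀ t ∈ Z, lastFiber U' t = lastFiber U t := by
    intro t ht
    ext s
    refine and_iff_left ?_
    rwa [mem_ofPred_eq, Fin.init_snoc]
  have hfib' : ∀ t ∉ Z, lastFiber U' t = ∅ := by
    intro t ht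
    refine eq_empty_of_forall_notMem fun s hs => ht ?_
    have := hs.2
    rwa [mem_ofPred_eq, Fin.init_snoc] at this
  have hU'd : A.Definable L U' := hU.inter (preimage_init_definable hZ)
  obtain ⟨W, hW, hcW, hdW⟩ := hd.exists_swap hU'd (a := a) (c := c) (by rwa [hfib _ hcZ])
    (by rw [hfib _ hcZ, hdX, Nat.cast_zero])
  have hVZ : {t | d 1 (lastFiber U' t) = ((0 : ℕ) : WithBot ℕ)} ⊆ Z := by
    intro t ht
    by_contra htZ
    rw [mem_ofPred_eq, hfib' t htZ, (hd.eq_bot_iff 1 ∅ definable_empty).2 rfl] at ht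
    simp at ht
  have hle : d 2 W ≤ (0 : ℕ) := by
    rw [hdW]
    refine (hd.mono ?_ (hZ.mono (subset_univ A)) hVZ).trans (by rw [hdZ, Nat.cast_zero])
    exact ((hd.fiber_definable 1 A U' hU'd 0 zero_le_one).mono (subset_univ A))
  have hWu := hW.mono (subset_univ A)
  have hcase : ∃ i ≤ 1, d 1 (lastFiber W (fun _ => a)) = ((i : ℕ) : WithBot ℕ) := by
    rcases hd.line_cases ((definable_lastFiber hW (fun _ => a)).mono (subset_univ _)) ⟨_, hcW⟩
      with h | h
    · exact ⟨0, zero_le_one, h⟩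
    · exact ⟨1, le_rfl, h⟩
  obtain ⟨i, hi, hai⟩ := hcase
  -- Either value of `i` will do: the points whose fibre in `W` has dimension `i` form a set of
  -- dimension at most that of `W`.
  refine hd.mem_matroid (hd.fiber_definable 1 A W hW i hi) (le_trans ?_ hle) hai
  refine le_trans ?_ (hd.fiber_add_le hWu hi)
  exact le_add_of_nonneg_right (by positivity)

/-- Only finitely many parameters from the closure occur, and `matroid_insert` removes them one at a
time. -/
theorem matroid_idempotent : matroidOfDim L d (matroidOfDim L d A) = matroidOfDim L d A := by
  refine Subset.antisymm ?_ hd.matroid_extension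
  rintro a ⟨X, hX, hdX, haX⟩
  obtain ⟨B, hBA, hB, hX⟩ := exists_finite_definable hX
  have key : ∀ B : Set N, B.Finite → B ⊆ matroidOfDim L d A →
      matroidOfDim L d (B ∪ A) ⊆ matroidOfDim L d A := by
    intro B hB
    induction B, hB using Set.Finite.induction_on with
    | empty => simp
    | @insert c B _ _ ih =>
      intro hcB a ha
      refine ih ((subset_insert c B).trans hcB) (hd.matroid_insert (c := c) ?_ ?_)
      · exact matroidOfDim_mono subset_union_right (hcB (mem_insert c B))
      · rwa [← insert_union]
  exact key B hB hBA (matroidOfDim_mono subset_union_left ⟨X, hX, hdX, haX⟩)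

/-- Double counting. Restricted to its fibres of dimension zero, the relation has the dimension of
its base, at most one. Along the other projection, if the fibre over `a` has dimension zero, it puts
`c` in the closure of `a` and `A`. If it has dimension one, the points with such fibres form a set
of dimension at most `1 - 1`, and `a` would lie in the closure of `A`. -/
theorem matroid_exchange {a c : N} (ha : a ∈ matroidOfDim L d (insert c A))
    (ha' : a ∉ matroidOfDim L d A) : c ∈ matroidOfDim L d (insert a A) := by
  obtain ⟨X, hX, hdX, haX⟩ := ha
  obtain ⟨U, hU, rfl⟩ := exists_lastFiber_of_insert hX
  obtain ⟨W, hW, hcW, hdW⟩ := hd.exists_swap hU haX (by rw [hdX, Nat.cast_zero])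
  have hWu := hW.mono (subset_univ A)
  have hfib := definable_lastFiber hW (fun _ => a)
  rcases hd.line_cases (hfib.mono (subset_univ _)) ⟨_, hcW⟩ with h | h
  · refine hd.mem_matroid (hfib.mono ?_) h.le hcW
    rw [range_const, union_singleton]
  · refine absurd ?_ ha'
    refine hd.mem_matroid (hd.fiber_definable 1 A W hW 1 le_rfl) ?_ h
    have hle := hd.fiber_add_le hWu (i := 1) le_rfl
    rw [hdW] at hle
    replace hle := hle.trans
      (hd.le_one ((hd.fiber_definable 1 A U hU 0 zero_le_one).mono (subset_univ A)))
    generalize d 1 _ = y at hle ⊢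
    induction y with
    | bot => exact bot_le
    | coe y =>
      change ((y + 1 : ℕ) : WithBot ℕ) ≤ _ at hle
      change ((y : ℕ) : WithBot ℕ) ≤ _
      rw [Nat.cast_le] at hle ⊢
      omega

/-- The dimension of the members of a definable family is definable. -/
theorem exists_dim_formula {m : ℕ} (φ : L.Formula (Fin 1 ⊕ Fin m)) {i : ℕ} (hi : i ≤ 1) :
    ∃ χ : L.Formula (Fin m), ∀ b : Fin m → N, d 1 (fiber φ b) = i ↔ χ.Realize b := by
  -- The family of all fibres as one relation without parameters: definability over the same
  -- parameters in the fibre axiom then yields a parameter-free formula.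
  let U : Set (Fin (m + 1) → N) := {s | φ.Realize (Sum.elim (fun _ => s (Fin.last m)) (Fin.init s))}
  have hU : (∅ : Set N).Definable L U := by
    rw [empty_definable_iff]
    refine ⟨φ.relabel (Sum.elim (fun _ => Fin.last m) Fin.castSucc), ?_⟩
    ext s
    rw [mem_ofPred_eq, mem_ofPred_eq, Formula.realize_relabel, Sum.comp_elim]
    rfl
  have hfib : ∀ b, lastFiber U b = fiber φ b := by
    intro b
    ext s
    change φ.Realize _ ↔ φ.Realize _
    rw [Fin.snoc_last, Fin.init_snoc, iff_iff_eq]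
    congr 2
    ext k
    rw [Subsingleton.elim k 0]
  obtain ⟨χ, hχ⟩ := empty_definable_iff.1 (hd.fiber_definable m ∅ U hU i hi)
  refine ⟨χ, fun b => ?_⟩
  rw [← hfib]
  exact Set.ext_iff.1 hχ b

variable {ν : Cardinal.{x}} (hN : IsMonster L ν N)

include hN

/-- A small family of sets of dimension one closed under intersections has a common point which is
not in the closure of the parameters. -/
theorem exists_generic {B : Set N} (hB : #B < ν) (F : Set (Set (Fin 1 → N)))
    (hFd : ∀ X ∈ F, B.Definable L X) (hF1 : ∀ X ∈ F, d 1 X = (1 : ℕ)) (hFu : univ ∈ F)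
    (hFi : ∀ X ∈ F, ∀ Y ∈ F, X ∩ Y ∈ F) :
    ∃ a, (∀ X ∈ F, (fun _ => a) ∈ X) ∧ a ∉ matroidOfDim L d B := by
  classical
  -- The type "in every member of `F` and in no `B`-definable set of dimension zero". Its formulas
  -- are those implied by membership in some `Y \ Z`, and this form survives finite conjunctions. It
  -- is finitely satisfiable since a set of dimension one is not contained in one of dimension at
  -- most zero.
  let p : Set (L[[B]].Formula (Fin 1)) := {φ | ∃ Y ∈ F, ∃ Z, B.Definable L Z ∧ d 1 Z ≤ (0 : ℕ) ∧
    ∀ t ∈ Y, t ∉ Z → φ.Realize t}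
  have hbot : d 1 ∅ ≤ ((0 : ℕ) : WithBot ℕ) := by
    rw [(hd.eq_bot_iff 1 ∅ definable_empty).2 rfl]
    exact bot_le
  obtain ⟨a, ha⟩ := hN.saturated B hB p (by
    intro q
    have key : (q : Set (L[[B]].Formula (Fin 1))) ⊆ p → ∃ Y ∈ F, ∃ Z, B.Definable L Z ∧
        d 1 Z ≤ (0 : ℕ) ∧ ∀ φ ∈ q, ∀ t ∈ Y, t ∉ Z → φ.Realize t := by
      induction q using Finset.induction_on with
      | empty => exact fun _ => ⟨univ, hFu, ∅, definable_empty, hbot, by simp⟩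
      | insert φ q _ ih =>
        intro hq
        rw [Finset.coe_insert, insert_subset_iff] at hq
        obtain ⟨Y, hY, Z, hZ, hdZ, hYZ⟩ := ih hq.2
        obtain ⟨Y', hY', Z', hZ', hdZ', hYZ'⟩ := hq.1
        refine ⟨Y ∩ Y', hFi _ hY _ hY', Z ∪ Z', hZ.union hZ', ?_, ?_⟩
        · rw [hd.union 1 Z Z' (hZ.mono (subset_univ _)) (hZ'.mono (subset_univ _))]
          exact max_le hdZ hdZ'
        · intro φ' hφ' t ht htZ
          rcases Finset.mem_insert.1 hφ' with rfl | hφ'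
          · exact hYZ' t ht.2 fun h => htZ (Or.inr h)
          · exact hYZ φ' hφ' t ht.1 fun h => htZ (Or.inl h)
    intro hq
    obtain ⟨Y, hY, Z, hZ, hdZ, hYZ⟩ := key hq
    have hne : ∃ t ∈ Y, t ∉ Z := by
      by_contra! hsub
      have := hd.mono ((hFd Y hY).mono (subset_univ _)) (hZ.mono (subset_univ _)) hsub
      rw [hF1 Y hY] at this
      have := this.trans hdZ
      rw [Nat.cast_le] at this
      omega
    obtain ⟨t, ht, htZ⟩ := hne
    refine ⟨t 0, fun φ hφ => ?_⟩
    have htt : (fun _ : Fin 1 => t 0) = t := funext fun k => by rw [Subsingleton.elim k 0]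
    rw [htt]
    exact hYZ φ hφ t ht htZ)
  refine ⟨a, fun X hX => ?_, ?_⟩
  · obtain ⟨φ, rfl⟩ := hFd X hX
    exact ha φ ⟨_, hX, ∅, definable_empty, hbot, fun t ht _ => ht⟩
  · rintro ⟨Z, hZ, hdZ, haZ⟩
    obtain ⟨φ, hφ⟩ := hZ.compl
    have : (fun _ => a) ∈ Zᶜ := by
      rw [hφ]
      refine ha φ ⟨univ, hFu, Z, hZ, by rw [hdZ, Nat.cast_zero], fun t _ ht => ?_⟩
      have : t ∈ Zᶜ := ht
      rwa [hφ] at this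
    exact this haZ

/-- A dimension function on a monster model induces an existential matroid. -/
theorem isExistentialMatroid : IsExistentialMatroid L ν (matroidOfDim L d) where
  extension X := hd.matroid_extension
  monotone X Y := matroidOfDim_mono
  idempotent X := hd.matroid_idempotent
  finitary X := by
    ext a
    simp only [mem_iUnion, exists_prop]
    constructor
    · rintro ⟨Z, hZ, h⟩
      obtain ⟨B, hBX, hB, hZ⟩ := exists_finite_definable hZ
      exact ⟨B, ⟨hBX, hB⟩, Z, hZ, h⟩
    · rintro ⟨B, hB, h⟩
      exact matroidOfDim_mono hB.1 h
  exchange X a c := hd.matroid_exchange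
  definable A a := by
    constructor
    · rintro ⟨X, hX, hdX, haX⟩
      obtain ⟨m, φ, b, hb, rfl⟩ := definable_iff_fiber.1 hX
      -- Adding to `φ` the clause that its fibre has dimension zero makes it narrow for all
      -- parameters, not only for `b`.
      obtain ⟨χ, hχ⟩ := hd.exists_dim_formula φ zero_le_one
      have hmem : ∀ (b : Fin m → N) (a : Fin 1 → N), a ∈ fiber (φ ⊓ χ.relabel Sum.inr) b ↔
          a ∈ fiber φ b ∧ d 1 (fiber φ b) = ((0 : ℕ) : WithBot ℕ) := by
        intro b a
        rw [mem_fiber, Formula.realize_inf, Formula.realize_relabel, Sum.elim_comp_inr, ← hχ]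
        rfl
      refine ⟨m, φ ⊓ χ.relabel Sum.inr, b, ?_, hb, (hmem _ _).2 ⟨haX, by rw [hdX, Nat.cast_zero]⟩⟩
      intro b' a' ha'
      obtain ⟨h1, h2⟩ := (hmem _ _).1 ha'
      exact hd.mem_matroid (definable_fiber φ mem_range_self) h2.le h1
    · rintro ⟨m, φ, b, hφ, hb, hab⟩
      exact matroidOfDim_mono (range_subset_iff.2 hb) (hφ b a hab)
  existence a B C hB hC ha := by
    -- The family is the type of `a` over `B`; its members have dimension one because `a` is not in
    -- the closure of `B`.
    obtain ⟨a', ha', hcl⟩ := hd.exists_generic hN (hN.union_lt hB hC)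
      {X | B.Definable L X ∧ (fun _ => a) ∈ X} (fun X hX => hX.1.mono subset_union_left) (by
        rintro X ⟨hX, haX⟩
        refine (hd.line_cases (hX.mono (subset_univ _)) ⟨_, haX⟩).resolve_left fun h => ha ?_
        exact hd.mem_matroid hX h.le haX) ⟨definable_univ, mem_univ _⟩
      fun X hX Y hY => ⟨hX.1.inter hY.1, hX.2, hY.2⟩
    refine ⟨a', fun m φ b hb => ⟨fun h => ha' _ ⟨definable_fiber φ hb, h⟩, fun h => ?_⟩, hcl⟩
    by_contra h'
    exact ha' _ ⟨(definable_fiber φ hb).compl, h'⟩ h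
  nontrivial := by
    obtain ⟨a, -, ha⟩ := hd.exists_generic hN (hN.lt_of_finite finite_empty) {univ} (by simp)
      (by simp [hd.line]) rfl (by simp)
    exact ⟨∅, fun h => ha (h ▸ mem_univ a)⟩

/-- The dimension of the induced matroid. -/
theorem dim_matroidOfDim {n : ℕ} {X : Set (Fin n → N)} (hX : univ.Definable L X) :
    dim L (matroidOfDim L d) X = d n X := by
  have h := hd.isExistentialMatroid hN
  -- Both functions are additive over fibres, so agreement on the line suffices: the induction
  -- splits `X` according to the dimension of its last fibres.
  have hline : ∀ X : Set (Fin 1 → N), univ.Definable L X → dim L (matroidOfDim L d) X = d 1 X := by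
    intro X hX
    rcases X.eq_empty_or_nonempty with rfl | hne
    · rw [(h.dim_eq_bot_iff hN hX).2 rfl, (hd.eq_bot_iff 1 _ hX).2 rfl]
    · obtain ⟨A, -, hA, hXA⟩ := exists_finite_definable hX
      rcases hd.line_cases hX hne with h0 | h1
      · rw [h0, withBot_eq_iff, h.zero_le_dim_iff hN hX, h.one_le_dim_iff hN hA hXA]
        refine ⟨hne, ?_⟩
        rintro ⟨c, hc, hc'⟩
        exact hc' (hd.mem_matroid hXA h0.le hc)
      · rw [h1, h.dim_eq_one_iff hN hA hXA]
        obtain ⟨a, ha, hcl⟩ := hd.exists_generic hN (hN.lt_of_finite hA)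
          {Y | A.Definable L Y ∧ X ⊆ Y} (fun Y hY => hY.1) (fun Y hY =>
            le_antisymm (hd.le_one (hY.1.mono (subset_univ _)))
              (h1.ge.trans (hd.mono hX (hY.1.mono (subset_univ _)) hY.2)))
          ⟨definable_univ, subset_univ _⟩ fun Y hY Y' hY' =>
            ⟨hY.1.inter hY'.1, subset_inter hY.2 hY'.2⟩
        exact ⟨a, ha X ⟨hXA, Subset.rfl⟩, hcl⟩
  induction n with
  | zero =>
    rcases X.eq_empty_or_nonempty with rfl | hne
    · rw [(h.dim_eq_bot_iff hN hX).2 rfl, (hd.eq_bot_iff 0 _ hX).2 rfl]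
    · rw [Subsingleton.eq_univ_of_nonempty hne, hd.point]
      exact le_antisymm (h.dim_le hN definable_univ)
        ((h.zero_le_dim_iff hN definable_univ).2 univ_nonempty)
  | succ n ih =>
    have hV : ∀ i : ℕ, i ≤ 1 → univ.Definable L {t | d 1 (lastFiber X t) = (i : WithBot ℕ)} :=
      fun i hi => hd.fiber_definable n _ X hX i hi
    have hpart : ∀ i : ℕ, i ≤ 1 → dim L (matroidOfDim L d)
        (X ∩ {t | Fin.init t ∈ {t | d 1 (lastFiber X t) = (i : WithBot ℕ)}}) =
        d (n + 1) (X ∩ {t | Fin.init t ∈ {t | d 1 (lastFiber X t) = (i : WithBot ℕ)}}) := by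
      intro i hi
      rw [h.dim_fiber_add hN hX (hV i hi) fun t ht => by
        rw [hline _ ((definable_lastFiber hX t).mono (subset_univ _))]; exact ht, ih (hV i hi)]
      exact (hd.fiber_add n X hX i hi).symm
    have hdef : ∀ i : ℕ, i ≤ 1 → univ.Definable L
        (X ∩ {t | Fin.init t ∈ {t | d 1 (lastFiber X t) = (i : WithBot ℕ)}}) :=
      fun i hi => hX.inter (preimage_init_definable (hV i hi))
    have hU : X = (X ∩ {t | Fin.init t ∈ {t | d 1 (lastFiber X t) = ((0 : ℕ) : WithBot ℕ)}}) ∪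
        (X ∩ {t | Fin.init t ∈ {t | d 1 (lastFiber X t) = ((1 : ℕ) : WithBot ℕ)}}) := by
      rw [← inter_union_distrib_left, eq_comm, inter_eq_left]
      intro t ht
      refine hd.line_cases ((definable_lastFiber hX (Fin.init t)).mono (subset_univ _))
        ⟨fun _ => t (Fin.last n), ?_⟩
      change Fin.snoc (α := fun _ => N) (Fin.init t) (t (Fin.last n)) ∈ X
      rwa [Fin.snoc_init_self]
    rw [hU, h.dim_union hN (hdef 0 zero_le_one) (hdef 1 le_rfl),
      hd.union _ _ _ (hdef 0 zero_le_one) (hdef 1 le_rfl), hpart 0 zero_le_one, hpart 1 le_rfl]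

end IsDimensionFunction

end

/-! ### The dimension axioms as formulas, and their transfer. -/

section Fibers

variable {L : FirstOrder.Language.{u, v}} {M : Type x} [L.Structure M] {n m : ℕ}

theorem fiber_top (b : Fin m → M) : fiber (⊤ : L.Formula (Fin n ⊕ Fin m)) b = univ :=
  eq_univ_of_forall fun _ => Formula.realize_top.2 trivial

theorem fiber_sup (φ φ' : L.Formula (Fin n ⊕ Fin m)) (b : Fin m → M) :
    fiber (φ ⊔ φ') b = fiber φ b ∪ fiber φ' b := by
  ext t
  exact Formula.realize_sup

theorem fiber_perm (φ : L.Formula (Fin n ⊕ Fin m)) (σ : Equiv.Perm (Fin n)) (b : Fin m → M) :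
    fiber (φ.relabel (Sum.map σ.symm id)) b = (fun t => t ∘ σ) '' fiber φ b := by
  ext t
  rw [mem_fiber_relabel, Sum.elim_comp_map]
  constructor
  · exact fun h => ⟨_, h, by simp [Function.comp_assoc]⟩
  · rintro ⟨s, hs, rfl⟩
    simpa [Function.comp_assoc, mem_fiber] using hs

end Fibers

section Transfer

variable {L : FirstOrder.Language.{u, v}} {I : Type w}

/-- Every formula which is valid in all structures `M i` is valid in `S`. -/
def Inherits (L : FirstOrder.Language.{u, v}) (M : I → Type y) [∀ i, L.Structure (M i)] (S : Type z)
    [L.Structure S] : Prop :=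
  ∀ (α : Type) [Finite α] (θ : L.Formula α),
    (∀ (i : I) (b : α → M i), θ.Realize b) → ∀ b : α → S, θ.Realize b

/-- The formulas `Ψ` define the function `d` on the definable sets. -/
def Represents (Ψ : ∀ n m : ℕ, L.Formula (Fin n ⊕ Fin m) → ℕ → L.Formula (Fin m)) {S : Type z}
    [L.Structure S] (d : ∀ n : ℕ, Set (Fin n → S) → WithBot ℕ) : Prop :=
  (∀ (n : ℕ) (X : Set (Fin n → S)), univ.Definable L X → d n X ≤ n) ∧
    ∀ (n m : ℕ) (φ : L.Formula (Fin n ⊕ Fin m)) (l : ℕ) (b : Fin m → S),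
      d n (fiber φ b) = l ↔ (Ψ n m φ l).Realize b

/-- Since there are finitely many variables, validity is expressed by the universal closure, a
sentence. -/
theorem valid_of_elementary {S : Type y} [L.Structure S] {N : Type z} [L.Structure N]
    (e : S ↪ₑ[L] N) {α : Type} [Finite α] (θ : L.Formula α) :
    (∀ b : α → S, θ.Realize b) ↔ ∀ b : α → N, θ.Realize b := by
  have := e.map_sentence (Formula.iAlls α (θ.relabel Sum.inr : L.Formula (Empty ⊕ α)))
  simpa only [Sentence.Realize, Formula.realize_iAlls, Formula.realize_relabel, Sum.elim_comp_inr]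
    using this

theorem Inherits.trans_elementary {M : I → Type y} [∀ i, L.Structure (M i)] {S : Type x}
    [L.Structure S] (h : Inherits L M S) {N : Type z} [L.Structure N] (e : S ↪ₑ[L] N) :
    Inherits L M N :=
  fun α _ θ hθ => (valid_of_elementary e θ).1 (h α θ hθ)

section

variable {M : I → Type y} [∀ i, L.Structure (M i)] {S : Type z} [L.Structure S]
  {Ψ : ∀ n m : ℕ, L.Formula (Fin n ⊕ Fin m) → ℕ → L.Formula (Fin m)}
  {D : ∀ (i : I) (n : ℕ), Set (Fin n → M i) → WithBot ℕ}

/-- Together with `inter_lastFiber`, this presents both sides of the additivity axiom as fibres of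
explicit formulas, so that `Ψ` can be applied to them again. -/
theorem Represents.setOf_lastFiber {d : ∀ n : ℕ, Set (Fin n → S) → WithBot ℕ}
    (hd : Represents Ψ d) {n m : ℕ} (φ : L.Formula (Fin (n + 1) ⊕ Fin m)) (b : Fin m → S) (i : ℕ) :
    {t | d 1 (lastFiber (fiber φ b) t) = (i : WithBot ℕ)} =
      fiber (splitFormula (Ψ _ _ (lastFormula φ) i)) b := by
  ext t
  rw [mem_fiber_splitFormula, ← hd.2, mem_ofPred_eq, lastFiber_fiber]

theorem Represents.inter_lastFiber {d : ∀ n : ℕ, Set (Fin n → S) → WithBot ℕ}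
    (hd : Represents Ψ d) {n m : ℕ} (φ : L.Formula (Fin (n + 1) ⊕ Fin m)) (b : Fin m → S) (i : ℕ) :
    fiber φ b ∩ {t | d 1 (lastFiber (fiber φ b) (Fin.init t)) = (i : WithBot ℕ)} =
      fiber (φ ⊓ (splitFormula (Ψ _ _ (lastFormula φ) i)).relabel (Sum.map Fin.castSucc id)) b := by
  ext t
  rw [mem_fiber, Formula.realize_inf, Formula.realize_relabel, Sum.elim_comp_map, mem_inter_iff]
  refine and_congr_right fun _ => ?_
  change Fin.init t ∈ {t | d 1 (lastFiber (fiber φ b) t) = (i : WithBot ℕ)} ↔ _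
  rw [hd.setOf_lastFiber]
  rfl

/-- For fixed formulas and fixed values, each axiom is an implication between formulas of `Ψ`. It is
valid in every `M i` and therefore in `S`. -/
theorem isDimensionFunction_of_represents (hS : Inherits L M S)
    (hD : ∀ i, IsDimensionFunction L (D i)) (hΨ : ∀ i, Represents Ψ (D i))
    {d : ∀ n : ℕ, Set (Fin n → S) → WithBot ℕ} (hd : Represents Ψ d) : IsDimensionFunction L d := by
  have hdef : ∀ {n m : ℕ} (φ : L.Formula (Fin n ⊕ Fin m)) {i : I} (b : Fin m → M i),
      univ.Definable L (fiber φ b) := fun φ i b => definable_fiber φ fun k => mem_univ (b k)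
  have hbot : ∀ (m : ℕ) (X : Set (Fin m → S)), univ.Definable L X → (d m X = ⊥ ↔ X = ∅) := by
    intro n X hX
    obtain ⟨m, φ, b, -, rfl⟩ := definable_iff_fiber.1 hX
    -- `Ψ` has no formula for the value `-∞`. It is recovered from two valid implications: a
    -- nonempty fibre has one of the values up to `n`, and a fibre with a value in `ℕ` is nonempty.
    have h1 := hS (Fin m) ((nonemptyFiber φ).imp (Formula.iSup fun l : Fin (n + 1) => Ψ n m φ l))
      (by
        intro i b
        rw [Formula.realize_imp, realize_nonemptyFiber, Formula.realize_iSup]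
        intro hne
        rcases withBot_cases ((hΨ i).1 n _ (hdef φ b)) with h | ⟨l, hl, h⟩
        · exact absurd (((hD i).eq_bot_iff n _ (hdef φ b)).1 h) hne.ne_empty
        · exact ⟨⟨l, by omega⟩, ((hΨ i).2 n m φ l b).1 h⟩) b
    have h2 : ∀ l : ℕ, _ := fun l => hS (Fin m) ((Ψ n m φ l).imp (nonemptyFiber φ)) (by
        intro i b
        rw [Formula.realize_imp, realize_nonemptyFiber, ← (hΨ i).2, nonempty_iff_ne_empty]
        intro hl he
        rw [((hD i).eq_bot_iff n _ (hdef φ b)).2 he] at hl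
        simp at hl) b
    rw [Formula.realize_imp, realize_nonemptyFiber, Formula.realize_iSup] at h1
    constructor
    · intro h
      by_contra hne
      obtain ⟨l, hl⟩ := h1 (nonempty_iff_ne_empty.2 hne)
      rw [← hd.2, h] at hl
      simp at hl
    · intro h
      rcases withBot_cases (hd.1 n _ hX) with h' | ⟨l, hl, h'⟩
      · exact h'
      · have := h2 l
        rw [Formula.realize_imp, realize_nonemptyFiber, ← hd.2] at this
        exact absurd h (this h').ne_empty
  have hfd : ∀ (m : ℕ) (A : Set S) (U : Set (Fin (m + 1) → S)), A.Definable L U →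
      ∀ i : ℕ, i ≤ 1 → A.Definable L {t | d 1 (lastFiber U t) = (i : WithBot ℕ)} := by
    intro m A U hU i hi
    obtain ⟨p, φ, b, hb, rfl⟩ := definable_iff_fiber.1 hU
    rw [hd.setOf_lastFiber]
    exact definable_fiber _ hb
  refine
  { eq_bot_iff := hbot
    singleton := ?_
    line := ?_
    union := ?_
    perm := ?_
    fiber_definable := hfd
    fiber_add := ?_ }
  · intro a
    have := hS (Fin 1) (Ψ 1 1 eqFormula 0) (by
      intro i b
      rw [← (hΨ i).2, fiber_eqFormula, (hD i).singleton, Nat.cast_zero]) fun _ => a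
    rw [← hd.2, fiber_eqFormula] at this
    rw [this, Nat.cast_zero]
  · have := hS (Fin 0) (Ψ 1 0 ⊤ 1) (by
      intro i b
      rw [← (hΨ i).2, fiber_top, (hD i).line, Nat.cast_one]) Fin.elim0
    rw [← hd.2, fiber_top] at this
    rw [this, Nat.cast_one]
  · intro n S₁ S₂ h₁ h₂
    have hmax : ∀ l₁ l₂ : ℕ, ((max l₁ l₂ : ℕ) : WithBot ℕ) = max (l₁ : WithBot ℕ) l₂ :=
      fun l₁ l₂ => (Nat.mono_cast (α := WithBot ℕ)).map_max
    rcases withBot_cases (hd.1 n _ h₁) with e₁ | ⟨l₁, hl₁, e₁⟩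
    · rw [e₁, (hbot n _ h₁).1 e₁, empty_union, bot_sup_eq]
    rcases withBot_cases (hd.1 n _ h₂) with e₂ | ⟨l₂, hl₂, e₂⟩
    · rw [e₂, (hbot n _ h₂).1 e₂, union_empty, sup_bot_eq]
    obtain ⟨m, φ₁, φ₂, b, -, rfl, rfl⟩ := exists_common_fiber h₁ h₂
    have := hS (Fin m) ((Ψ n m φ₁ l₁).imp ((Ψ n m φ₂ l₂).imp (Ψ n m (φ₁ ⊔ φ₂) (max l₁ l₂)))) (by
      intro i b
      rw [Formula.realize_imp, Formula.realize_imp, ← (hΨ i).2, ← (hΨ i).2, ← (hΨ i).2, fiber_sup,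
        (hD i).union n _ _ (hdef _ _) (hdef _ _)]
      intro h h'
      rw [h, h', hmax]) b
    rw [Formula.realize_imp, Formula.realize_imp, ← hd.2, ← hd.2, ← hd.2, fiber_sup] at this
    rw [this e₁ e₂, e₁, e₂, hmax]
  · intro n X σ hX
    rcases withBot_cases (hd.1 n _ hX) with e | ⟨l, hl, e⟩
    · rw [e, (hbot n _ hX).1 e, image_empty, (hbot n ∅ definable_empty).2 rfl]
    obtain ⟨m, φ, b, -, rfl⟩ := definable_iff_fiber.1 hX
    have := hS (Fin m) ((Ψ n m φ l).imp (Ψ n m (φ.relabel (Sum.map σ.symm id)) l)) (by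
      intro i b
      rw [Formula.realize_imp, ← (hΨ i).2, ← (hΨ i).2, fiber_perm, (hD i).perm n _ σ (hdef _ _)]
      exact id) b
    rw [Formula.realize_imp, ← hd.2, ← hd.2, fiber_perm] at this
    rw [this e, e]
  · intro n U hU i hi
    have hV := hfd n _ U hU i hi
    rcases withBot_cases (hd.1 n _ hV) with e | ⟨l, hl, e⟩
    · rw [e, WithBot.bot_add]
      refine (hbot _ _ (hU.inter (preimage_init_definable hV))).2 ?_
      refine eq_empty_of_forall_notMem fun t ht => ?_
      have : Fin.init t ∈ (∅ : Set (Fin n → S)) := (hbot n _ hV).1 e ▸ ht.2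
      exact this
    obtain ⟨m, φ, b, -, rfl⟩ := definable_iff_fiber.1 hU
    have := hS (Fin m) ((Ψ n m (splitFormula (Ψ _ _ (lastFormula φ) i)) l).imp (Ψ (n + 1) m
      (φ ⊓ (splitFormula (Ψ _ _ (lastFormula φ) i)).relabel (Sum.map Fin.castSucc id)) (l + i))) (by
      intro j b
      rw [Formula.realize_imp, ← (hΨ j).2, ← (hΨ j).2, ← (hΨ j).setOf_lastFiber,
        ← (hΨ j).inter_lastFiber, (hD j).fiber_add n _ (hdef _ _) i hi]
      intro h
      rw [h, Nat.cast_add]) b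
    rw [Formula.realize_imp, ← hd.2, ← hd.2, ← hd.setOf_lastFiber, ← hd.inter_lastFiber] at this
    rw [this e, e, Nat.cast_add]

open Classical in
/-- The function on definable sets which is defined by the formulas `Ψ`. -/
noncomputable def dimOfFormulas (Ψ : ∀ n m : ℕ, L.Formula (Fin n ⊕ Fin m) → ℕ → L.Formula (Fin m))
    (n : ℕ) (X : Set (Fin n → S)) : WithBot ℕ :=
  if h : ∃ l ≤ n, ∃ (m : ℕ) (φ : L.Formula (Fin n ⊕ Fin m)) (b : Fin m → S),
    X = fiber φ b ∧ (Ψ n m φ l).Realize b then (h.choose : WithBot ℕ) else ⊥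

/-- The definition makes sense because three facts are inherited from the `M i`: the value depends
only on the fibre, is at most `n`, and is unique. -/
theorem represents_dimOfFormulas (hS : Inherits L M S) (hΨ : ∀ i, Represents Ψ (D i)) :
    Represents Ψ (dimOfFormulas Ψ (S := S)) := by
  have hcompat : ∀ {n m m' l : ℕ} {φ : L.Formula (Fin n ⊕ Fin m)} {φ' : L.Formula (Fin n ⊕ Fin m')}
      {b : Fin m → S} {b' : Fin m' → S}, fiber φ b = fiber φ' b' →
      (Ψ n m φ l).Realize b → (Ψ n m' φ' l).Realize b' := by
    intro n m m' l φ φ' b b' hb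
    have := hS (Fin m ⊕ Fin m') ((sameFiber φ φ').imp
      (((Ψ n m φ l).relabel Sum.inl).imp ((Ψ n m' φ' l).relabel Sum.inr))) (by
      intro i c
      rw [← Sum.elim_comp_inl_inr c]
      rw [Formula.realize_imp, Formula.realize_imp, realize_sameFiber, Formula.realize_relabel,
        Formula.realize_relabel, Sum.elim_comp_inl, Sum.elim_comp_inr, ← (hΨ i).2, ← (hΨ i).2]
      intro h h'
      rwa [← Set.ext h]) (Sum.elim b b')
    rw [Formula.realize_imp, Formula.realize_imp, realize_sameFiber, Formula.realize_relabel,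
        Formula.realize_relabel, Sum.elim_comp_inl, Sum.elim_comp_inr] at this
    exact this fun a => by rw [hb]
  have hle : ∀ {n m l : ℕ} {φ : L.Formula (Fin n ⊕ Fin m)} {b : Fin m → S},
      (Ψ n m φ l).Realize b → l ≤ n := by
    intro n m l φ b hl
    by_contra hnl
    have := hS (Fin m) (Ψ n m φ l).not (by
      intro i b
      rw [Formula.realize_not, ← (hΨ i).2]
      intro h
      have := (hΨ i).1 n _ (definable_fiber φ fun k => mem_univ (b k))
      rw [h, Nat.cast_le] at this
      exact hnl this) b
    exact Formula.realize_not.1 this hl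
  have huniq : ∀ {n m l l' : ℕ} {φ : L.Formula (Fin n ⊕ Fin m)} {b : Fin m → S},
      (Ψ n m φ l).Realize b → (Ψ n m φ l').Realize b → l = l' := by
    intro n m l l' φ b hl hl'
    by_contra hne
    have := hS (Fin m) ((Ψ n m φ l).imp (Ψ n m φ l').not) (by
      intro i b
      rw [Formula.realize_imp, Formula.realize_not, ← (hΨ i).2, ← (hΨ i).2]
      intro h h'
      rw [h, Nat.cast_inj] at h'
      exact hne h') b
    rw [Formula.realize_imp, Formula.realize_not] at this
    exact this hl hl'
  refine ⟨fun n X _ => ?_, fun n m φ l b => ?_⟩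
  · unfold dimOfFormulas
    split_ifs with h
    · exact Nat.cast_le.2 h.choose_spec.1
    · exact bot_le
  · constructor
    · intro h
      unfold dimOfFormulas at h
      split_ifs at h with hex
      · rw [Nat.cast_inj] at h
        obtain ⟨-, m', φ', b', hb', hr⟩ := hex.choose_spec
        rw [h] at hr
        exact hcompat hb'.symm hr
      · simp at h
    · intro h
      have hex : ∃ l ≤ n, ∃ (m' : ℕ) (φ' : L.Formula (Fin n ⊕ Fin m')) (b' : Fin m' → S),
          fiber φ b = fiber φ' b' ∧ (Ψ n m' φ' l).Realize b' := ⟨l, hle h, m, φ, b, rfl, h⟩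
      rw [dimOfFormulas, dif_pos hex, Nat.cast_inj]
      obtain ⟨-, m', φ', b', hb', hr⟩ := hex.choose_spec
      exact huniq (hcompat hb'.symm hr) h

end

/-- Both functions are read off the same parameter-free formulas, which `e` preserves; `-∞` is the
case in which none of them holds. -/
theorem extendsDim_of_represents {K : Type x} [L.Structure K] {N : Type z} [L.Structure N]
    {Ψ : ∀ n m : ℕ, L.Formula (Fin n ⊕ Fin m) → ℕ → L.Formula (Fin m)}
    {d : ∀ n : ℕ, Set (Fin n → K) → WithBot ℕ} {d' : ∀ n : ℕ, Set (Fin n → N) → WithBot ℕ}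
    (hd : Represents Ψ d) (hd' : Represents Ψ d') (e : K ↪ₑ[L] N) : ExtendsDim e d d' := by
  intro n m φ b
  have key : ∀ l : ℕ, d' n (fiber φ (e ∘ b)) = l ↔ d n (fiber φ b) = l := by
    intro l
    rw [hd.2, hd'.2, e.map_formula]
  rcases withBot_cases (hd.1 n _ (definable_fiber φ fun k => mem_univ (b k))) with h | ⟨l, -, h⟩
  · rw [h]
    rcases withBot_cases (hd'.1 n _ (definable_fiber φ fun k => mem_univ ((e ∘ b) k)))
      with h' | ⟨l, -, h'⟩
    · exact h'
    · rw [(key l).1 h'] at h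
      simp at h
  · rw [h, key, h]

/-- The matroid induced by an extension of `d` restricts to the operator induced by `d`. -/
theorem preimage_matroidOfDim {K : Type x} [L.Structure K] {N : Type z} [L.Structure N]
    {d : ∀ n : ℕ, Set (Fin n → K) → WithBot ℕ} {d' : ∀ n : ℕ, Set (Fin n → N) → WithBot ℕ}
    {e : K ↪ₑ[L] N} (h : ExtendsDim e d d') (A : Set K) :
    e ⁻¹' matroidOfDim L d' (e '' A) = matroidOfDim L d A := by
  ext a
  constructor
  · rintro ⟨X, hX, hdX, haX⟩
    obtain ⟨m, φ, b, hb, rfl⟩ := definable_iff_fiber.1 hX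
    choose c hc hcb using hb
    obtain rfl : e ∘ c = b := funext hcb
    rw [h] at hdX
    exact ⟨_, definable_fiber φ hc, hdX, (comp_mem_fiber_comp e φ c fun _ => a).1 haX⟩
  · rintro ⟨X, hX, hdX, haX⟩
    obtain ⟨m, φ, b, hb, rfl⟩ := definable_iff_fiber.1 hX
    rw [← h] at hdX
    exact ⟨_, definable_fiber φ fun k => ⟨_, hb k, rfl⟩, hdX,
      (comp_mem_fiber_comp e φ b fun _ => a).2 haX⟩

theorem UniformlyDefinable.exists_represents {M : I → Type y} [∀ i, L.Structure (M i)]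
    {κ : I → Cardinal.{y}} {cl : ∀ i, Set (M i) → Set (M i)} (hM : ∀ i, IsMonster L (κ i) (M i))
    (h : ∀ i, IsExistentialMatroid L (κ i) (cl i)) (hU : UniformlyDefinable L cl) :
    ∃ Ψ : ∀ n m : ℕ, L.Formula (Fin n ⊕ Fin m) → ℕ → L.Formula (Fin m),
      ∀ i, Represents Ψ fun n (V : Set (Fin n → M i)) => dim L (cl i) V := by
  have hex : ∀ (n m : ℕ) (φ : L.Formula (Fin n ⊕ Fin m)) (l : ℕ), ∃ ψ : L.Formula (Fin m),
      ∀ (i : I) (b : Fin m → M i), dim L (cl i) (fiber φ b) = (l : WithBot ℕ) ↔ ψ.Realize b := by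
    intro n m φ l
    by_cases hl : l ≤ n
    · exact hU n m φ l hl
    · refine ⟨⊥, fun i b => ?_⟩
      rw [Formula.realize_bot, iff_false]
      intro hd
      have := (h i).dim_le (hM i) (definable_fiber φ fun k => mem_univ (b k))
      rw [hd, Nat.cast_le] at this
      exact hl this
  choose Ψ hΨ using hex
  exact ⟨Ψ, fun i => ⟨fun n X hX => (h i).dim_le (hM i) hX, fun n m φ l b => hΨ n m φ l i b⟩⟩

end Transfer

/-! ### The ultralimit of the dimensions. -/

section Ultraproduct

variable {L : FirstOrder.Language.{u, v}} {I : Type w} {μ : Ultrafilter I} {K : I → Type x}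
  [∀ i, L.Structure (K i)]

theorem exists_ultraMk {α : Type*} (t : α → (μ : Filter I).Product K) :
    ∃ a : α → ∀ i, K i, t = fun k => ultraMk μ (a k) :=
  ⟨fun k => (t k).out, funext fun k => (Quotient.out_eq (t k)).symm⟩

theorem ultraMk_eq_iff {a a' : ∀ i, K i} :
    ultraMk μ a = ultraMk μ a' ↔ ∀ᶠ i in (μ : Filter I), a i = a' i :=
  Quotient.eq''

theorem realize_ultraMk [∀ i, Nonempty (K i)] {α : Type*} (φ : L.Formula α) (a : α → ∀ i, K i) :
    φ.Realize (fun k => ultraMk μ (a k)) ↔ ∀ᶠ i in (μ : Filter I), φ.Realize fun k => a k i :=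
  Ultraproduct.realize_formula_cast φ a

theorem mem_fiber_ultraMk [∀ i, Nonempty (K i)] {n m : ℕ} (φ : L.Formula (Fin n ⊕ Fin m))
    (b : Fin m → ∀ i, K i) (a : Fin n → ∀ i, K i) :
    (fun k => ultraMk μ (a k)) ∈ fiber φ (fun k => ultraMk μ (b k)) ↔
      ∀ᶠ i in (μ : Filter I), (fun k => a k i) ∈ fiber φ fun k => b k i := by
  have := realize_ultraMk (μ := μ) φ (Sum.elim a b)
  rw [mem_fiber, show (Sum.elim (fun k => ultraMk μ (a k)) fun k => ultraMk μ (b k)) =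
    fun k => ultraMk μ (Sum.elim a b k) from funext fun k => by rcases k with k | k <;> rfl, this]
  refine eventually_congr (Eventually.of_forall fun i => ?_)
  rw [mem_fiber, show (Sum.elim (fun k => a k i) fun k => b k i) = fun k => Sum.elim a b k i from
    funext fun k => by rcases k with k | k <;> rfl]

theorem fiber_ultraMk [∀ i, Nonempty (K i)] {n m : ℕ} (φ : L.Formula (Fin n ⊕ Fin m))
    (b : Fin m → ∀ i, K i) :
    fiber φ (fun k => ultraMk μ (b k)) = ultraSet μ fun i => fiber φ fun k => b k i := by
  ext t
  obtain ⟨a, rfl⟩ := exists_ultraMk t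
  constructor
  · exact fun h => ⟨a, rfl, (mem_fiber_ultraMk φ b a).1 h⟩
  · rintro ⟨a', ha', h⟩
    rw [ha']
    exact (mem_fiber_ultraMk φ b a').2 h

/-- If the inclusions fail on a large set of indices, witnesses of the failure form an element of
one product that is not in the other. Hence the components of a product are determined almost
everywhere, as `ultraDim` requires. -/
theorem eventually_subset_of_ultraSet [∀ i, Nonempty (K i)] {n : ℕ}
    {Y Y' : ∀ i, Set (Fin n → K i)} (h : ultraSet μ Y ⊆ ultraSet μ Y') :
    ∀ᶠ i in (μ : Filter I), Y i ⊆ Y' i := by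
  by_contra hcon
  rw [← Ultrafilter.eventually_not] at hcon
  have hex : ∀ i, ∃ a : Fin n → K i, ¬ Y i ⊆ Y' i → a ∈ Y i ∧ a ∉ Y' i := by
    intro i
    by_cases hi : Y i ⊆ Y' i
    · exact ⟨fun _ => Classical.arbitrary _, fun h => absurd hi h⟩
    · obtain ⟨a, ha⟩ := not_subset.1 hi
      exact ⟨a, fun _ => ha⟩
  choose a ha using hex
  obtain ⟨a', haa', ha'⟩ := h ⟨fun k i => a i k, rfl, hcon.mono fun i hi => (ha i hi).1⟩
  have heq : ∀ᶠ i in (μ : Filter I), ∀ k, a i k = a' k i :=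
    eventually_all.2 fun k => ultraMk_eq_iff.1 (congrFun haa' k)
  obtain ⟨i, ⟨h1, h2⟩, h3⟩ := ((hcon.and heq).and ha').exists
  refine (ha i h1).2 ?_
  rwa [show a i = fun k => a' k i from funext h2]

theorem eventually_eq_of_ultraSet [∀ i, Nonempty (K i)] {n : ℕ}
    {Y Y' : ∀ i, Set (Fin n → K i)} (h : ultraSet μ Y = ultraSet μ Y') :
    ∀ᶠ i in (μ : Filter I), Y i = Y' i :=
  ((eventually_subset_of_ultraSet h.subset).and (eventually_subset_of_ultraSet h.superset)).mono
    fun _ hi => hi.1.antisymm hi.2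

theorem exists_ultraSet [∀ i, Nonempty (K i)] {n : ℕ} {X : Set (Fin n → (μ : Filter I).Product K)}
    (hX : univ.Definable L X) :
    ∃ Y : ∀ i, Set (Fin n → K i), (∀ i, univ.Definable L (Y i)) ∧ X = ultraSet μ Y := by
  obtain ⟨m, φ, b, -, rfl⟩ := definable_iff_fiber.1 hX
  obtain ⟨b, rfl⟩ := exists_ultraMk b
  exact ⟨_, fun i => definable_fiber φ fun k => mem_univ _, fiber_ultraMk φ b⟩

/-- Only the values `⊥, 0, …, n` can occur, and an ultrafilter selects one of finitely many. -/
theorem eventually_eq_ultraDim [∀ i, Nonempty (K i)] {n : ℕ}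
    {D : ∀ i, ∀ n : ℕ, Set (Fin n → K i) → WithBot ℕ}
    (hD : ∀ i (X : Set (Fin n → K i)), univ.Definable L X → D i n X ≤ n)
    {Y : ∀ i, Set (Fin n → K i)} (hY : ∀ i, univ.Definable L (Y i)) :
    ∀ᶠ i in (μ : Filter I), D i n (Y i) = ultraDim L μ D n (ultraSet μ Y) := by
  obtain ⟨l, -, hl⟩ : ∃ l ∈ {x : WithBot ℕ | x ≤ n}, μ.map (fun i => D i n (Y i)) = pure l := by
    refine Ultrafilter.eq_pure_of_finite_mem ?_ (Eventually.of_forall fun i => hD i _ (hY i) :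
      ∀ᶠ i in (μ : Filter I), D i n (Y i) ≤ n)
    refine ((finite_Iic n).image ((↑) : ℕ → WithBot ℕ) |>.insert ⊥).subset fun x hx => ?_
    rcases withBot_cases hx with rfl | ⟨l, hl, rfl⟩
    · exact Or.inl rfl
    · exact Or.inr ⟨l, hl, rfl⟩
  have hl' : ∀ᶠ i in (μ : Filter I), D i n (Y i) = l := by
    have : {l} ∈ μ.map fun i => D i n (Y i) := by
      rw [hl]
      exact Ultrafilter.mem_pure.2 rfl
    exact this
  have hex : ∃ l : WithBot ℕ, ∃ Y' : ∀ i, Set (Fin n → K i), (∀ i, univ.Definable L (Y' i)) ∧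
      ultraSet μ Y = ultraSet μ Y' ∧ ∀ᶠ i in (μ : Filter I), D i n (Y' i) = l :=
    ⟨l, Y, hY, rfl, hl'⟩
  rw [ultraDim, dif_pos hex]
  obtain ⟨Y', -, hYY', hd⟩ := hex.choose_spec
  filter_upwards [eventually_eq_of_ultraSet hYY', hd] with i hi hdi
  rw [hi, hdi]

theorem inherits_ultraproduct {M : I → Type y} [∀ i, L.Structure (M i)] [∀ i, Nonempty (K i)]
    (j : ∀ i, K i ↪ₑ[L] M i) : Inherits L M ((μ : Filter I).Product K) := by
  intro α _ θ hθ b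
  obtain ⟨b, rfl⟩ := exists_ultraMk b
  rw [realize_ultraMk]
  exact Eventually.of_forall fun i => (valid_of_elementary (j i) θ).2 (hθ i) _

theorem inducedDim_fiber {K : Type x} [L.Structure K] {M : Type y} [L.Structure M]
    (j : K ↪ₑ[L] M) (cl : Set M → Set M) {n m : ℕ} (φ : L.Formula (Fin n ⊕ Fin m)) (b : Fin m → K) :
    inducedDim j cl n (fiber φ b) = dim L cl (fiber φ (j ∘ b)) := by
  rw [inducedDim, extendSet_fiber]

theorem inducedDim_le {K : Type x} [L.Structure K] {M : Type y} [L.Structure M]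
    (j : K ↪ₑ[L] M) {κ : Cardinal.{y}} {cl : Set M → Set M} (hM : IsMonster L κ M)
    (h : IsExistentialMatroid L κ cl) {n : ℕ} {X : Set (Fin n → K)} (hX : univ.Definable L X) :
    inducedDim j cl n X ≤ n := by
  obtain ⟨m, φ, b, -, rfl⟩ := definable_iff_fiber.1 hX
  rw [inducedDim_fiber]
  exact h.dim_le hM (definable_fiber φ fun k => mem_univ _)

theorem IsExistentialMatroid.nonempty {M : Type y} [L.Structure M] {κ : Cardinal.{y}}
    {cl : Set M → Set M} (h : IsExistentialMatroid L κ cl) : Nonempty M := by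
  obtain ⟨X, hX⟩ := h.nontrivial
  obtain ⟨a, -⟩ := (ne_univ_iff_exists_notMem (cl X)).1 hX
  exact ⟨a⟩

/-- The formula `⊥` in one free variable is valid exactly in the empty structure. -/
theorem nonempty_of_elementary {K : Type x} [L.Structure K] {M : Type y} [L.Structure M]
    (j : K ↪ₑ[L] M) [Nonempty M] : Nonempty K := by
  by_contra hK
  have := (valid_of_elementary j (⊥ : L.Formula (Fin 1))).1
    (fun b => (hK ⟨b 0⟩).elim) fun _ => Classical.arbitrary M
  exact Formula.realize_bot.1 this

variable {M : I → Type y} [∀ i, L.Structure (M i)] {j : ∀ i, K i ↪ₑ[L] M i}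
  {κ : I → Cardinal.{y}} {cl : ∀ i, Set (M i) → Set (M i)}

theorem eventually_eq_limitDim (hM : ∀ i, IsMonster L (κ i) (M i))
    (hcl : ∀ i, IsExistentialMatroid L (κ i) (cl i)) [∀ i, Nonempty (K i)] {n : ℕ}
    {Y : ∀ i, Set (Fin n → K i)} (hY : ∀ i, univ.Definable L (Y i)) :
    ∀ᶠ i in (μ : Filter I), inducedDim (j i) (cl i) n (Y i) =
      limitDim μ j cl n (ultraSet μ Y) :=
  eventually_eq_ultraDim (fun i _ hX => inducedDim_le (j i) (hM i) (hcl i) hX) hY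

theorem eventually_dim_eq_limitDim (hM : ∀ i, IsMonster L (κ i) (M i))
    (hcl : ∀ i, IsExistentialMatroid L (κ i) (cl i)) [∀ i, Nonempty (K i)] {n m : ℕ}
    (φ : L.Formula (Fin n ⊕ Fin m)) (b : Fin m → ∀ i, K i) :
    ∀ᶠ i in (μ : Filter I), dim L (cl i) (fiber φ (j i ∘ fun k => b k i)) =
      limitDim μ j cl n (fiber φ fun k => ultraMk μ (b k)) := by
  rw [fiber_ultraMk]
  filter_upwards [eventually_eq_limitDim (j := j) hM hcl (Y := fun i => fiber φ fun k => b k i)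
    fun i => definable_fiber φ fun k => mem_univ _] with i hi
  rw [← hi, inducedDim_fiber]

/-- By Łoś, `Ψ` holds in the ultraproduct iff it holds in almost every `K i`, equivalently for the
image in `M i`, where it computes the dimension. -/
theorem represents_limitDim (hM : ∀ i, IsMonster L (κ i) (M i))
    (hcl : ∀ i, IsExistentialMatroid L (κ i) (cl i)) [∀ i, Nonempty (K i)]
    {Ψ : ∀ n m : ℕ, L.Formula (Fin n ⊕ Fin m) → ℕ → L.Formula (Fin m)}
    (hΨ : ∀ i, Represents Ψ fun n (V : Set (Fin n → M i)) => dim L (cl i) V) :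
    Represents Ψ (limitDim μ j cl) := by
  constructor
  · intro n X hX
    obtain ⟨Y, hY, rfl⟩ := exists_ultraSet hX
    obtain ⟨i, hi⟩ := (eventually_eq_limitDim (j := j) hM hcl (μ := μ) hY).exists
    rw [← hi]
    exact inducedDim_le (j i) (hM i) (hcl i) (hY i)
  · intro n m φ l b
    obtain ⟨b, rfl⟩ := exists_ultraMk b
    have hev := eventually_dim_eq_limitDim (j := j) hM hcl (μ := μ) φ b
    rw [realize_ultraMk]
    constructor
    · intro h
      filter_upwards [hev] with i hi
      rw [h, (hΨ i).2] at hi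
      exact ((j i).map_formula _ _).1 hi
    · intro h
      obtain ⟨i, hi, hi'⟩ := (hev.and h).exists
      rw [← hi]
      exact ((hΨ i).2 n m φ l _).2 (((j i).map_formula _ _).2 hi')

/-- Membership in the matroid of the ultraproduct implies membership almost everywhere. -/
theorem eventually_mem_cl (hM : ∀ i, IsMonster L (κ i) (M i))
    (hcl : ∀ i, IsExistentialMatroid L (κ i) (cl i)) [∀ i, Nonempty (K i)] {a : ∀ i, K i} {m : ℕ}
    {b : Fin m → ∀ i, K i}
    (h : ultraMk μ a ∈ matroidOfDim L (limitDim μ j cl) (range fun k => ultraMk μ (b k))) :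
    ∀ᶠ i in (μ : Filter I), j i (a i) ∈ cl i (range fun k => j i (b k i)) := by
  obtain ⟨X, hX, hd, haX⟩ := h
  obtain ⟨p, φ, c, hc, rfl⟩ := definable_iff_fiber.1 hX
  choose f hf using hc
  obtain rfl : (fun k => ultraMk μ (b (f k))) = c := funext hf
  -- For almost every `i` the fibre over the components of `b` has dimension zero and contains `a
  -- i`, and such a fibre lies in the closure of its parameters.
  filter_upwards [eventually_dim_eq_limitDim (j := j) hM hcl (μ := μ) φ fun k => b (f k),
    (mem_fiber_ultraMk φ _ fun _ => a).1 haX] with i hi hai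
  rw [hd] at hi
  refine (hcl i).mem_cl_of_dim_eq_zero (hM i) (finite_range _) (definable_fiber φ fun k => ?_)
    (hi.trans Nat.cast_zero.symm) ((comp_mem_fiber_comp (j i) φ _ _).2 hai)
  exact ⟨f k, rfl⟩

end Ultraproduct

/-! ### Rings without zero divisors. -/

section Domain

/-- The laws of the operation `x + a * y` of a ring without zero divisors which are used to define
the dimension. -/
def Separates {M : Type x} (g : M → M → M → M) : Prop :=
  (∀ a a' x y x' y', y ≠ y' → g x a y = g x' a y' → g x a' y = g x' a' y' → a = a') ∧
    ∀ a x x' y, g x a y = g x' a y → x = x'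

variable {L : FirstOrder.Language.{u, v}} {M : Type x} [L.Structure M]

/-- The operation `x + a * y`. -/
def affineOp (s : RingSymbols L) (x a y : M) : M :=
  Structure.funMap s.add ![x, Structure.funMap s.mul ![a, y] ]

/-- Subtracting the two equations leaves `(a - a') * (y - y') = 0`. -/
theorem separates_of_expandsDomain {s : RingSymbols L} (h : ExpandsDomain s M) :
    Separates (affineOp s (M := M)) := by
  obtain ⟨_, _, -, -, hadd, hmul⟩ := h
  simp only [Separates, affineOp, hadd, hmul]
  refine ⟨fun a a' x y x' y' hne h h' => ?_, fun a x x' y h => add_right_cancel h⟩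
  have hprod : (a - a') * (y - y') = 0 := by
    have : a * (y - y') - a' * (y - y') = (x + a * y) - (x' + a * y') -
      ((x + a' * y) - (x' + a' * y')) := by noncomm_ring
    rw [sub_mul, this, h, h']
    simp
  rcases mul_eq_zero.1 hprod with h0 | h0
  · exact sub_eq_zero.1 h0
  · exact absurd (sub_eq_zero.1 h0) hne

/-- The term `x + a * y`. -/
def affineTerm (s : RingSymbols L) {α : Type*} (x a y : L.Term α) : L.Term α :=
  Functions.apply₂ s.add x (Functions.apply₂ s.mul a y)

theorem realize_affineTerm (s : RingSymbols L) {α : Type*} (x a y : L.Term α) (v : α → M) :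
    (affineTerm s x a y).realize v = affineOp s (x.realize v) (a.realize v) (y.realize v) := by
  rw [affineTerm, affineOp, Term.realize_functions_apply₂, Term.realize_functions_apply₂]

/-- The two laws are single formulas, so they pass to the monster model without a ring structure
being rebuilt there. -/
theorem separates_elementary {N : Type y} [L.Structure N] (e : M ↪ₑ[L] N) {s : RingSymbols L}
    (h : Separates (affineOp s (M := M))) :
    Separates (affineOp s (M := N)) := by
  let t : Fin 6 → L.Term (Fin 6) := Term.var
  constructor
  · have := (valid_of_elementary e ((t 3).equal (t 5) ⊔
      ((affineTerm s (t 2) (t 0) (t 3)).equal (affineTerm s (t 4) (t 0) (t 5))).imp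
      (((affineTerm s (t 2) (t 1) (t 3)).equal (affineTerm s (t 4) (t 1) (t 5))).imp
        ((t 0).equal (t 1))))).1 (by
      intro b
      simp only [Formula.realize_sup, Formula.realize_imp, Formula.realize_equal,
        realize_affineTerm]
      exact or_iff_not_imp_left.2 fun hne => h.1 (b 0) (b 1) (b 2) (b 3) (b 4) (b 5) hne)
    intro a a' x y x' y' hne
    have := this ![a, a', x, y, x', y']
    simp only [Formula.realize_sup, Formula.realize_imp, Formula.realize_equal,
        realize_affineTerm] at this
    exact this.resolve_left hne
  · have := (valid_of_elementary e
      (((affineTerm s (t 1) (t 0) (t 3)).equal (affineTerm s (t 2) (t 0) (t 3))).imp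
        ((t 1).equal (t 2)))).1 (by
      intro b
      simp only [Formula.realize_imp, Formula.realize_equal, realize_affineTerm]
      exact h.2 (b 0) (b 1) (b 2) (b 3))
    intro a x x' y
    have := this ![a, x, x', y, y, y]
    simp only [Formula.realize_imp, Formula.realize_equal, realize_affineTerm] at this
    exact this

namespace IsExistentialMatroid

variable {κ : Cardinal.{x}} {cl : Set M → Set M} (h : IsExistentialMatroid L κ cl)
  (hM : IsMonster L κ M)

include h hM

/-- An element which is definable over a finite set belongs to its closure. -/
theorem mem_cl_of_definable {A : Set M} (hA : A.Finite) {a : M} {X : Set (Fin 1 → M)}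
    (hX : A.Definable L X) (ha : (fun _ => a) ∈ X) (huniq : ∀ c, (fun _ => c) ∈ X → c = a) :
    a ∈ cl A := by
  by_contra hcl
  -- An element of the same type over `A` but outside the closure of `A` and `a` would still lie in
  -- `X`, hence would equal `a`.
  obtain ⟨a', hT, ha'⟩ := h.existence a A {a} (hM.lt_of_finite hA)
    (hM.lt_of_finite (finite_singleton a)) hcl
  obtain rfl := huniq a' ((hT.definable hX).1 ha)
  exact ha' (h.extension _ (Or.inr rfl))

theorem exists_notMem_cl {A : Set M} (hA : A.Finite) : ∃ a, a ∉ cl A := by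
  obtain ⟨X, hX⟩ := h.nontrivial
  obtain ⟨c, hc⟩ := (ne_univ_iff_exists_notMem (cl X)).1 hX
  obtain ⟨a, -, ha⟩ := h.existence c ∅ A (hM.lt_of_finite finite_empty) (hM.lt_of_finite hA)
    fun hc' => hc (h.monotone _ _ (empty_subset X) hc')
  exact ⟨a, by rwa [empty_union] at ha⟩

theorem exists_mem_notMem_cl {A B : Set M} (hA : A.Finite) (hB : B.Finite) {X : Set (Fin 1 → M)}
    (hX : A.Definable L X) {c : M} (hc : (fun _ => c) ∈ X) (hcA : c ∉ cl A) :
    ∃ x, (fun _ => x) ∈ X ∧ x ∉ cl (A ∪ B) := by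
  obtain ⟨x, hT, hx⟩ := h.existence c A B (hM.lt_of_finite hA) (hM.lt_of_finite hB) hcA
  exact ⟨x, (hT.definable hX).1 hc, hx⟩

/-- In an expansion of a ring without zero divisors, the sets of dimension one are those whose
quotients of differences exhaust the ring. -/
theorem dim_eq_one_iff_of_separates {s : RingSymbols L} (hs : Separates (affineOp s (M := M)))
    {X : Set (Fin 1 → M)}
    (hX : univ.Definable L X) :
    dim L cl X = (1 : ℕ) ↔ ∀ a : M, ∃ c : Fin 4 → M, (∀ k, (fun _ => c k) ∈ X) ∧ c 1 ≠ c 3 ∧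
      affineOp s (c 0) a (c 1) = affineOp s (c 2) a (c 3) := by
  obtain ⟨A, -, hA, hXA⟩ := exists_finite_definable hX
  rw [h.dim_eq_one_iff hM hA hXA]
  constructor
  -- If `a` is not obtained, take independent `x, y` in `X` over `A` and `a`. Then `z = x + a * y`
  -- determines both, while exchange puts `z` in the closure of `y` and the base. Hence `x`, too,
  -- depends on `y`, a contradiction.
  · rintro ⟨c, hc, hcA⟩ a
    by_contra! hcon
    obtain ⟨x, hx, hxA⟩ := h.exists_mem_notMem_cl hM hA (finite_singleton a) hXA hc hcA
    obtain ⟨y, hy, hyA⟩ := h.exists_mem_notMem_cl hM hA ((finite_singleton a).union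
      (finite_singleton x)) hXA hc hcA
    rw [← union_assoc] at hyA
    set B := A ∪ {a} with hB
    have hBfin : B.Finite := hA.union (finite_singleton a)
    have haB : a ∈ B := Or.inr rfl
    set z := affineOp s x a y with hz
    have hinj : ∀ x' y', (fun _ => x') ∈ X → (fun _ => y') ∈ X →
        affineOp s x' a y' = z → x' = x ∧ y' = y := by
      intro x' y' hx' hy' hz'
      have hyy' : y' = y := by
        by_contra hne
        refine hcon ![x', y', x, y] (fun k => ?_) hne hz'
        fin_cases k
        · exact hx'
        · exact hy'
        · exact hx
        · exact hy
      subst hyy'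
      exact ⟨hs.2 a _ _ _ hz', rfl⟩
    have hfin : (insert z B).Finite := hBfin.insert z
    let t : Fin 2 → L.Term ((insert z B : Set M) ⊕ Fin 2) := fun k => Term.var (Sum.inr k)
    have hgraph : (insert z B).Definable L {p : Fin 2 → M | (fun _ => p 0) ∈ X ∧
        (fun _ => p 1) ∈ X ∧
        affineOp s (p 0) a (p 1) = z} := by
      have hXz : (insert z B).Definable L X :=
        hXA.mono (subset_union_left.trans (subset_insert z B))
      have haff : (insert z B).Definable L {p : Fin 2 → M | affineOp s (p 0) a (p 1) = z} := by
        rw [definable_iff_exists_formula_sum]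
        refine ⟨(affineTerm s (t 0) (Term.var (Sum.inl ⟨a, Or.inr haB⟩)) (t 1)).equal
          (Term.var (Sum.inl ⟨z, Or.inl rfl⟩)), ?_⟩
        ext p
        simp only [mem_ofPred_eq, Formula.realize_equal, realize_affineTerm, t,
          Term.realize_var, Sum.elim_inl, Sum.elim_inr]
      exact (hXz.preimage_comp (fun _ : Fin 1 => (0 : Fin 2))).inter
        ((hXz.preimage_comp (fun _ : Fin 1 => (1 : Fin 2))).inter haff)
    have hxz : x ∈ cl (insert z B) := by
      refine h.mem_cl_of_definable hM hfin (hgraph.image_comp (fun _ : Fin 1 => (0 : Fin 2)))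
        ⟨![x, y], ⟨hx, hy, rfl⟩, rfl⟩ ?_
      rintro x' ⟨p, ⟨hp0, hp1, hp⟩, hpx⟩
      rw [← (hinj _ _ hp0 hp1 hp).1]
      exact (congrFun hpx 0).symm
    have hyz : y ∈ cl (insert z B) := by
      refine h.mem_cl_of_definable hM hfin (hgraph.image_comp (fun _ : Fin 1 => (1 : Fin 2)))
        ⟨![x, y], ⟨hx, hy, rfl⟩, rfl⟩ ?_
      rintro y' ⟨p, ⟨hp0, hp1, hp⟩, hpy⟩
      rw [← (hinj _ _ hp0 hp1 hp).2]
      exact (congrFun hpy 0).symm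
    rw [union_singleton] at hyA
    have hyB : y ∉ cl B := fun hy' => hyA (h.monotone _ _ (subset_insert x B) hy')
    have hzy : z ∈ cl (insert y B) := h.exchange B y z hyz hyB
    have hxy : x ∈ cl (insert y B) :=
      h.cl_le (insert_subset hzy ((subset_insert y B).trans (h.extension _))) hxz
    exact hyA (h.exchange B x y hxy hxA)
  · intro hall
    by_contra! hcon
    -- If `X` were inside the closure of `A`, so would be every `a`, being the unique solution of an
    -- equation with coefficients in `X`.
    obtain ⟨a, ha⟩ := h.exists_notMem_cl hM hA
    obtain ⟨c, hcX, hne, hc⟩ := hall a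
    refine ha (h.cl_le (X := range c) ?_ ?_)
    · rintro _ ⟨k, rfl⟩
      exact hcon _ (hcX k)
    · have hdef : (range c).Definable L {p : Fin 1 → M |
          affineOp s (c 0) (p 0) (c 1) =
          affineOp s (c 2) (p 0) (c 3)} := by
        rw [definable_iff_exists_formula_sum]
        let t : Fin 4 → L.Term (range c ⊕ Fin 1) := fun k => Term.var (Sum.inl ⟨c k, k, rfl⟩)
        refine ⟨(affineTerm s (t 0) (Term.var (Sum.inr 0)) (t 1)).equal
          (affineTerm s (t 2) (Term.var (Sum.inr 0)) (t 3)), ?_⟩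
        ext p
        simp only [mem_ofPred_eq, Formula.realize_equal, realize_affineTerm, t,
          Term.realize_var, Sum.elim_inl, Sum.elim_inr]
      exact h.mem_cl_of_definable hM (finite_range c) hdef hc fun a' ha' =>
        hs.1 _ _ _ _ _ _ hne ha' hc

end IsExistentialMatroid

/-- The formula expressing that the quotients of differences of a fibre exhaust the ring. -/
noncomputable def quotientFormula (s : RingSymbols L) {m : ℕ} (φ : L.Formula (Fin 1 ⊕ Fin m)) :
    L.Formula (Fin m) :=
  Formula.iAlls (Fin 1) (Formula.iExs (Fin 4)
    (Formula.iInf (fun k : Fin 4 => φ.relabel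
      (Sum.elim (fun _ => Sum.inr k) fun i => Sum.inl (Sum.inl i))) ⊓
      ((Term.var (Sum.inr 1)).equal (Term.var (Sum.inr 3))).not ⊓
      (affineTerm s (Term.var (Sum.inr 0)) (Term.var (Sum.inl (Sum.inr 0)))
        (Term.var (Sum.inr 1))).equal
      (affineTerm s (Term.var (Sum.inr 2)) (Term.var (Sum.inl (Sum.inr 0)))
        (Term.var (Sum.inr 3)))))

theorem realize_quotientFormula (s : RingSymbols L) {m : ℕ} (φ : L.Formula (Fin 1 ⊕ Fin m))
    (b : Fin m → M) : (quotientFormula s φ).Realize b ↔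
      ∀ a : M, ∃ c : Fin 4 → M, (∀ k, (fun _ => c k) ∈ fiber φ b) ∧ c 1 ≠ c 3 ∧
      affineOp s (c 0) a (c 1) = affineOp s (c 2) a (c 3) := by
  rw [quotientFormula, Formula.realize_iAlls]
  refine ⟨fun h a => ?_, fun h a => ?_⟩
  · have := h fun _ => a
    rw [Formula.realize_iExs] at this
    obtain ⟨c, hc⟩ := this
    simp only [Formula.realize_inf, Formula.realize_iInf, Formula.realize_relabel, Sum.comp_elim,
      Formula.realize_not, Formula.realize_equal, realize_affineTerm, Term.realize_var,
      Sum.elim_inl, Sum.elim_inr] at hc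
    exact ⟨c, hc.1.1, hc.1.2, hc.2⟩
  · rw [Formula.realize_iExs]
    obtain ⟨c, hc, hne, heq⟩ := h (a 0)
    refine ⟨c, ?_⟩
    simp only [Formula.realize_inf, Formula.realize_iInf, Formula.realize_relabel, Sum.comp_elim,
      Formula.realize_not, Formula.realize_equal, realize_affineTerm, Term.realize_var,
      Sum.elim_inl, Sum.elim_inr]
    exact ⟨⟨hc, hne⟩, heq⟩

/-- The dimension is uniformly definable in expansions of rings without zero divisors. -/
theorem uniformlyDefinable_of_expandsDomain {I : Type w} {K : I → Type x} [∀ i, L.Structure (K i)]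
    {M : I → Type y} [∀ i, L.Structure (M i)] (j : ∀ i, K i ↪ₑ[L] M i)
    {κ : I → Cardinal.{y}} {cl : ∀ i, Set (M i) → Set (M i)} (hM : ∀ i, IsMonster L (κ i) (M i))
    (h : ∀ i, IsExistentialMatroid L (κ i) (cl i)) (s : RingSymbols L)
    (hs : ∀ i, ExpandsDomain s (K i)) : UniformlyDefinable L cl :=
  uniformlyDefinable_of_line hM h fun _ φ => ⟨quotientFormula s φ, fun i b => by
    rw [(h i).dim_eq_one_iff_of_separates (hM i) (separates_elementary (j i)
      (separates_of_expandsDomain (hs i))) (definable_fiber φ fun k => mem_univ (b k)),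
      realize_quotientFormula]⟩

end Domain

/-! ### Sets with countably many distinguished points -/

section Pointed

/-- The language with a constant for every natural number. -/
abbrev pointLanguage : FirstOrder.Language.{0, 0} := FirstOrder.Language.constantsOn ℕ

/-- The constant with index `k`, as a closed term. -/
def pointTerm {α : Type*} (k : ℕ) : pointLanguage.Term α :=
  Constants.term (show pointLanguage.Constants from k)

theorem exists_notMem_of_lt {M : Type x} {A : Set M} (hA : #A < #M) : ∃ a, a ∉ A := by
  by_contra! h
  rw [eq_univ_of_forall h, Cardinal.mk_univ] at hA
  exact lt_irrefl _ hA

variable {M : Type x} [pointLanguage.Structure M]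

/-- The distinguished point with index `k`. -/
def point (M : Type x) [pointLanguage.Structure M] (k : ℕ) : M :=
  ((show pointLanguage.Constants from k : pointLanguage.Constants) : M)

theorem realize_pointTerm {α : Type*} (k : ℕ) (v : α → M) : (pointTerm k).realize v = point M k :=
  Term.realize_constants

/-- The closure operator which adds the distinguished points. -/
def pointClosure (X : Set M) : Set M := X ∪ range (point M)

theorem term_support {α : Type*} (t : pointLanguage.Term α) : ∃ F : Finset ℕ,
    ∀ σ : Equiv.Perm M, (∀ k ∈ F, σ (point M k) = point M k) → ∀ v : α → M,
      t.realize (σ ∘ v) = σ (t.realize v) := by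
  rcases t with a | ⟨f, ts⟩
  · exact ⟨∅, fun σ _ v => rfl⟩
  · rename_i l
    cases l with
    | zero =>
      refine ⟨{(show ℕ from f)}, fun σ hσ v => ?_⟩
      have key : ∀ v : α → M, (Term.func f ts).realize v = point M (show ℕ from f) := fun v =>
        congrArg (Structure.funMap f) (Subsingleton.elim _ _)
      rw [key, key]
      exact (hσ _ (Finset.mem_singleton_self _)).symm
    | succ l => exact isEmptyElim f

/-- `F` collects the constants that occur in the formula. A permutation fixing those points
preserves the formula, whatever it does to the other named points. -/
theorem formula_support {α : Type*} {n : ℕ} (φ : pointLanguage.BoundedFormula α n) :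
    ∃ F : Finset ℕ, ∀ σ : Equiv.Perm M, (∀ k ∈ F, σ (point M k) = point M k) →
      ∀ (v : α → M) (xs : Fin n → M), φ.Realize (σ ∘ v) (σ ∘ xs) ↔ φ.Realize v xs := by
  induction φ with
  | falsum => exact ⟨∅, fun _ _ _ _ => Iff.rfl⟩
  | equal t₁ t₂ =>
    obtain ⟨F₁, h₁⟩ := term_support (M := M) t₁
    obtain ⟨F₂, h₂⟩ := term_support (M := M) t₂
    refine ⟨F₁ ∪ F₂, fun σ hσ v xs => ?_⟩
    simp only [BoundedFormula.Realize]
    rw [← Sum.comp_elim, h₁ σ fun k hk => hσ k (Finset.mem_union_left _ hk),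
      h₂ σ fun k hk => hσ k (Finset.mem_union_right _ hk), σ.injective.eq_iff]
  | rel R => exact isEmptyElim R
  | imp φ₁ φ₂ ih₁ ih₂ =>
    obtain ⟨F₁, h₁⟩ := ih₁
    obtain ⟨F₂, h₂⟩ := ih₂
    refine ⟨F₁ ∪ F₂, fun σ hσ v xs => ?_⟩
    rw [BoundedFormula.realize_imp, BoundedFormula.realize_imp,
      h₁ σ fun k hk => hσ k (Finset.mem_union_left _ hk),
      h₂ σ fun k hk => hσ k (Finset.mem_union_right _ hk)]
  | all φ ih =>
    obtain ⟨F, h⟩ := ih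
    refine ⟨F, fun σ hσ v xs => ?_⟩
    rw [BoundedFormula.realize_all, BoundedFormula.realize_all, σ.surjective.forall]
    refine forall_congr' fun a => ?_
    rw [← Fin.comp_snoc, h σ hσ]

/-- Elements outside a finite set cannot be distinguished by a formula. -/
theorem fiber_support {m : ℕ} (φ : pointLanguage.Formula (Fin 1 ⊕ Fin m)) : ∃ F : Finset ℕ,
    ∀ (b : Fin m → M) (a a' : M), a ∉ range b ∪ point M '' F → a' ∉ range b ∪ point M '' F →
      (fun _ => a) ∈ fiber φ b → (fun _ => a') ∈ fiber φ b := by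
  classical
  obtain ⟨F, hF⟩ := formula_support (M := M) φ
  refine ⟨F, fun b a a' ha ha' h => ?_⟩
  -- The transposition of `a` and `a'` fixes the parameters and the points that matter to `φ`.
  have hfix : ∀ c ∈ range b ∪ point M '' F, Equiv.swap a a' c = c := fun c hc =>
    Equiv.swap_apply_of_ne_of_ne (fun h => ha (h ▸ hc)) fun h => ha' (h ▸ hc)
  have := (hF (Equiv.swap a a') (fun k hk => hfix _ (Or.inr ⟨k, hk, rfl⟩))
    (Sum.elim (fun _ => a) b) default).2 h
  rw [Sum.comp_elim, show Equiv.swap a a' ∘ b = b from funext fun k => hfix _ (Or.inl ⟨k, rfl⟩),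
    show (Equiv.swap a a' ∘ fun _ : Fin 1 => a) = fun _ => a' from
      funext fun _ => Equiv.swap_apply_left a a'] at this
  rw [mem_fiber, Formula.Realize]
  convert this using 1

theorem definable_support {A : Set M} {X : Set (Fin 1 → M)} (hX : A.Definable pointLanguage X) :
    ∃ F : Set M, F.Finite ∧ F ⊆ pointClosure A ∧
      ∀ a a' : M, a ∉ F → a' ∉ F → (fun _ => a) ∈ X → (fun _ => a') ∈ X := by
  obtain ⟨m, φ, b, hb, rfl⟩ := definable_iff_fiber.1 hX
  obtain ⟨F, hF⟩ := fiber_support (M := M) φ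
  refine ⟨_, (finite_range b).union (F.finite_toSet.image (point M)), ?_, hF b⟩
  exact union_subset_union (range_subset_iff.2 hb) (image_subset_range _ _)

theorem pointClosure_lt (hM : ℵ₀ < #M) {A : Set M} (hA : #A < #M) : #(pointClosure A) < #M :=
  (Cardinal.mk_union_le _ _).trans_lt (Cardinal.add_lt_of_lt hM.le hA
    (((Cardinal.mk_le_aleph0_iff.2 (countable_range (point M)).to_subtype)).trans_lt hM))

theorem isMonster_point (hM : ℵ₀ < #M) : IsMonster pointLanguage #M M where
  card_lt := by
    rw [card_constantsOn, Cardinal.mk_nat, max_self]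
    simpa using hM
  saturated := by
    intro A hA p hp
    -- If `x`, which lies outside the closure of `A`, violates some `φ` in `p`, then `φ` has
    -- realisations only in a finite set `F`. If no element realises `p`, each element of `F`
    -- violates some formula of `p`, and these finitely many formulas together with `φ` are
    -- inconsistent.
    obtain ⟨x, hx⟩ := exists_notMem_of_lt (pointClosure_lt hM hA)
    by_contra! hcon
    obtain ⟨φ, hφ, hφx⟩ := hcon x
    obtain ⟨F, hF, hFA, hsupp⟩ := definable_support (X := {t | φ.Realize t}) ⟨φ, rfl⟩
    choose f hf hf' using hcon
    classical
    obtain ⟨a, ha⟩ := hp (insert φ (hF.toFinset.image f)) (by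
      intro ψ hψ
      rcases Finset.mem_insert.1 hψ with rfl | hψ
      · exact hφ
      · obtain ⟨c, -, rfl⟩ := Finset.mem_image.1 hψ
        exact hf c)
    have haφ := ha φ (Finset.mem_insert_self _ _)
    have haF : a ∈ F := by
      by_contra haF
      exact hφx (hsupp a x haF (fun h => hx (hFA h)) haφ)
    exact hf' a (ha (f a) (Finset.mem_insert_of_mem
      (Finset.mem_image_of_mem f (hF.mem_toFinset.2 haF))))
  homogeneous := by
    intro A hA f hf
    classical
    have hinj : Function.Injective f := by
      intro a a' h
      have := (hf ((Term.var a).equal (Term.var a'))).2 h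
      exact Subtype.ext this
    have hpt : ∀ (a : A) (k : ℕ), f a = point M k ↔ (a : M) = point M k := by
      intro a k
      have := hf ((Term.var a).equal (pointTerm k))
      rw [Formula.realize_equal, Formula.realize_equal, realize_pointTerm, realize_pointTerm] at this
      exact this.symm
    -- `f` is extended by the identity on the named points. The result is injective because `f`
    -- preserves and reflects being the point with a given index, and by cardinality it extends to a
    -- permutation, which is then an automorphism.
    let g : (pointClosure A).Elem → M := fun a => if ha : (a : M) ∈ A then f ⟨a, ha⟩ else a
    have hg : ∀ k (hk : point M k ∈ pointClosure A), g ⟨point M k, hk⟩ = point M k := by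
      intro k hk
      by_cases h : point M k ∈ A
      · simp only [g, h, dite_true]
        exact (hpt ⟨_, h⟩ k).2 rfl
      · simp only [g, h, dite_false]
    have hginj : Function.Injective g := by
      have hmix : ∀ (a b : (pointClosure A).Elem), (a : M) ∈ A → (b : M) ∉ A → g a ≠ g b := by
        intro a b ha hb h
        obtain ⟨k, hk⟩ := b.2.resolve_left hb
        have hb' : g b = point M k := by simp only [g, hb, dite_false]; exact hk.symm
        rw [hb'] at h
        simp only [g, ha, dite_true] at h
        exact hb (by rw [← hk, ← (hpt ⟨a, ha⟩ k).1 h]; exact ha)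
      intro a b h
      by_cases ha : (a : M) ∈ A <;> by_cases hb : (b : M) ∈ A
      · simp only [g, ha, hb, dite_true] at h
        exact Subtype.ext (Subtype.mk.inj (hinj h))
      · exact absurd h (hmix a b ha hb)
      · exact absurd h.symm (hmix b a hb ha)
      · simp only [g, ha, hb, dite_false] at h
        exact Subtype.ext h
    obtain ⟨σ, hσ⟩ := Cardinal.extend_function_of_lt ⟨g, hginj⟩ (pointClosure_lt hM hA)
      ⟨Equiv.refl M⟩
    have hσpt : ∀ k, σ (point M k) = point M k := fun k =>
      (hσ ⟨point M k, Or.inr ⟨k, rfl⟩⟩).trans (hg k _)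
    refine ⟨⟨σ, fun {n} c v => ?_, fun {n} r => isEmptyElim r⟩, fun a => ?_⟩
    · cases n with
      | zero =>
        have h0 : ∀ v : Fin 0 → M, Structure.funMap c v = point M (show ℕ from c) := fun v =>
          congrArg (Structure.funMap c) (Subsingleton.elim _ _)
        rw [h0, h0]
        exact hσpt _
      | succ n => exact isEmptyElim c
    · refine (hσ ⟨a, Or.inl a.2⟩).trans ?_
      simp [g]

theorem isExistentialMatroid_point (hM : ℵ₀ < #M) :
    IsExistentialMatroid pointLanguage #M (pointClosure (M := M)) where
  extension X := subset_union_left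
  monotone X Y h := union_subset_union_left _ h
  idempotent X := by simp only [pointClosure, union_assoc, union_self]
  finitary X := by
    ext a
    simp only [mem_iUnion, exists_prop]
    constructor
    · rintro (h | h)
      · exact ⟨{a}, ⟨singleton_subset_iff.2 h, finite_singleton a⟩, Or.inl rfl⟩
      · exact ⟨∅, ⟨empty_subset X, finite_empty⟩, Or.inr h⟩
    · rintro ⟨B, hB, h⟩
      exact union_subset_union_left _ hB.1 h
  exchange X a c h h' := by
    rcases h with (rfl | h) | h
    · exact Or.inl (Or.inl rfl)
    · exact absurd (Or.inl h) h'
    · exact absurd (Or.inr h) h'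
  definable A a := by
    constructor
    · rintro (h | ⟨k, rfl⟩)
      · refine ⟨1, eqFormula, fun _ => a, ?_, fun _ => h, ?_⟩
        · intro b a' ha'
          rw [fiber_eqFormula] at ha'
          exact Or.inl ⟨0, (congrFun ha' 0).symm⟩
        · rw [fiber_eqFormula]
          rfl
      · have hmem : ∀ (b : Fin 0 → M) (a : M), (fun _ => a) ∈ fiber ((Term.var (Sum.inl 0)).equal
            (pointTerm k) : pointLanguage.Formula (Fin 1 ⊕ Fin 0)) b ↔ a = point M k := by
          intro b a
          rw [mem_fiber, Formula.realize_equal, realize_pointTerm]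
          rfl
        exact ⟨0, _, Fin.elim0, fun b a' ha' => Or.inr ⟨k, ((hmem b a').1 ha').symm⟩,
          fun i => i.elim0, (hmem _ _).2 rfl⟩
    · rintro ⟨m, φ, b, hφ, hb, hab⟩
      exact union_subset_union_left _ (range_subset_iff.2 hb) (hφ b a hab)
  existence a B C hB hC ha := by
    have hBC : #(B ∪ C : Set M) < #M :=
      (Cardinal.mk_union_le _ _).trans_lt (Cardinal.add_lt_of_lt hM.le hB hC)
    -- Any element outside the closure of `B ∪ C` will do: elements outside the closure of `B` all
    -- have the same type over `B`.
    obtain ⟨a', ha'⟩ := exists_notMem_of_lt (pointClosure_lt hM hBC)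
    refine ⟨a', fun m φ b hb => ?_, ha'⟩
    obtain ⟨F, -, hFB, hsupp⟩ := definable_support (definable_fiber φ hb)
    have h1 : a ∉ F := fun h => ha (hFB h)
    have h2 : a' ∉ F := fun h => ha' (union_subset_union_left _ subset_union_left (hFB h))
    exact ⟨hsupp a a' h1 h2, hsupp a' a h2 h1⟩
  nontrivial := by
    obtain ⟨a, ha⟩ := exists_notMem_of_lt (pointClosure_lt hM (A := ∅) (by
      rw [Cardinal.mk_eq_zero]
      exact Cardinal.aleph0_pos.trans hM))
    exact ⟨∅, fun h => ha (h ▸ mem_univ a)⟩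

/-- Only the finitely many named points in the support of `φ` have to be avoided: `φ` does not
distinguish any other point from a generic element. That `F` does not depend on `b` gives both
uniform definability and the failure of the converse of (3). -/
theorem dim_point_eq_one_iff (hM : ℵ₀ < #M) {m : ℕ} (φ : pointLanguage.Formula (Fin 1 ⊕ Fin m)) :
    ∃ F : Finset ℕ, ∀ b : Fin m → M, dim pointLanguage pointClosure (fiber φ b) = (1 : ℕ) ↔
      ∃ c, (fun _ => c) ∈ fiber φ b ∧ c ∉ range b ∪ point M '' F := by
  obtain ⟨F, hF⟩ := fiber_support (M := M) φ
  refine ⟨F, fun b => ?_⟩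
  rw [(isExistentialMatroid_point hM).dim_eq_one_iff (isMonster_point hM) (finite_range b)
    (definable_fiber φ mem_range_self)]
  have hsub : range b ∪ point M '' F ⊆ pointClosure (range b) :=
    union_subset_union_right _ (image_subset_range _ _)
  constructor
  · rintro ⟨c, hc, hcb⟩
    exact ⟨c, hc, fun h => hcb (hsub h)⟩
  · rintro ⟨c, hc, hcb⟩
    have hM' := isMonster_point hM
    obtain ⟨c', hc'⟩ := exists_notMem_of_lt
      (pointClosure_lt hM (hM'.lt_of_finite (finite_range b)))
    exact ⟨c', hF b c c' hcb (fun h => hc' (hsub h)) hc, hc'⟩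

theorem uniformlyDefinable_point (hM : ℵ₀ < #M) (I : Type w) :
    UniformlyDefinable pointLanguage (fun _ : I => pointClosure (M := M)) := by
  refine uniformlyDefinable_of_line (fun _ => isMonster_point hM)
    (fun _ => isExistentialMatroid_point hM) fun m φ => ?_
  obtain ⟨F, hF⟩ := dim_point_eq_one_iff hM φ
  let χ : pointLanguage.Formula (Fin 1 ⊕ Fin m) := φ ⊓
    (Formula.iInf fun k : Fin m => ((Term.var (Sum.inl 0)).equal (Term.var (Sum.inr k))).not) ⊓
    (Formula.iInf fun k : F => ((Term.var (Sum.inl 0)).equal (pointTerm (k : ℕ))).not)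
  refine ⟨nonemptyFiber χ, fun _ b => ?_⟩
  rw [hF, realize_nonemptyFiber]
  have hχ : ∀ t : Fin 1 → M, t ∈ fiber χ b ↔ t ∈ fiber φ b ∧ t 0 ∉ range b ∪ point M '' F := by
    intro t
    simp only [χ, mem_fiber, Formula.realize_inf, Formula.realize_iInf, Formula.realize_not,
      Formula.realize_equal, realize_pointTerm, Term.realize_var, Sum.elim_inl, Sum.elim_inr,
      mem_union, not_or, and_assoc]
    refine and_congr_right fun _ => and_congr ?_ ?_
    · exact ⟨fun h ⟨k, hk⟩ => h k hk.symm, fun h k hk => h ⟨k, hk.symm⟩⟩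
    · exact ⟨fun h ⟨k, hk, hk'⟩ => h ⟨k, hk⟩ hk'.symm, fun h k hk => h ⟨k, k.2, hk.symm⟩⟩
  constructor
  · rintro ⟨c, hc⟩
    exact ⟨_, (hχ _).2 hc⟩
  · rintro ⟨t, ht⟩
    have htt : (fun _ : Fin 1 => t 0) = t := funext fun k => by rw [Subsingleton.elim k 0]
    exact ⟨t 0, by rw [htt]; exact (hχ t).1 ht⟩

/-- A nonstandard point is not in the closure of the empty set. -/
theorem point_notMem_matroidOfDim (hM : ℵ₀ < #M) (hinj : Function.Injective (point M)) :
    ultraMk (hyperfilter ℕ) (fun i : ℕ => point M i) ∉ matroidOfDim pointLanguage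
      (limitDim (hyperfilter ℕ) (fun _ : ℕ => ElementaryEmbedding.refl pointLanguage M)
        fun _ => pointClosure)
      (range fun k : Fin 0 => ultraMk (hyperfilter ℕ) ((fun k => k.elim0 : Fin 0 → ℕ → M) k)) := by
  have : Nonempty M := ⟨point M 0⟩
  rintro ⟨X, hX, hd, haX⟩
  obtain ⟨p, φ, c, hc, rfl⟩ := definable_iff_fiber.1 hX
  have hp : IsEmpty (Fin p) := ⟨fun k => by obtain ⟨l, -⟩ := hc k; exact l.elim0⟩
  obtain rfl : (fun k => ultraMk (hyperfilter ℕ) ((fun k => hp.elim k : Fin p → ℕ → M) k)) = c :=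
    funext fun k => hp.elim k
  obtain ⟨F, hF⟩ := dim_point_eq_one_iff hM φ
  have hcof : ∀ᶠ i in (hyperfilter ℕ : Filter ℕ), i ∉ F := by
    have : ∀ᶠ i in cofinite, i ∉ F := F.finite_toSet.compl_mem_cofinite
    exact this.filter_mono hyperfilter_le_cofinite
  obtain ⟨i, ⟨hi, hai⟩, hiF⟩ := ((eventually_dim_eq_limitDim (μ := hyperfilter ℕ)
    (j := fun _ : ℕ => ElementaryEmbedding.refl pointLanguage M) (fun _ => isMonster_point hM)
    (fun _ => isExistentialMatroid_point hM) φ _).and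
    ((mem_fiber_ultraMk φ _ fun _ => _).1 haX) |>.and hcof).exists
  -- For `i` outside `F`, a fibre of `φ` containing the `i`-th point has dimension one, against the
  -- dimension zero of the chosen set.
  have h1 := (hF _).2 ⟨point M i, hai, ?_⟩
  · have h0 := hi.trans (hd.trans Nat.cast_zero.symm)
    have := h1.symm.trans h0
    rw [Nat.cast_inj] at this
    omega
  · rintro (⟨k, -⟩ | ⟨k, hk, hki⟩)
    · exact hp.elim k
    · exact hiF (hinj hki ▸ hk)

end Pointed

end ExistentialMatroid

theorem mainTheorem10 {L : FirstOrder.Language.{u, v}} {I : Type w} [Infinite I] (μ : Ultrafilter I)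
    (K : I → Type x) [∀ i, L.Structure (K i)]
    (M : I → Type y) [∀ i, L.Structure (M i)] (j : ∀ i, K i ↪ₑ[L] M i)
    (κ : I → Cardinal.{y}) (hM : ∀ i, ExistentialMatroid.IsMonster L (κ i) (M i))
    (cl : ∀ i, Set (M i) → Set (M i))
    (hcl : ∀ i, ExistentialMatroid.IsExistentialMatroid L (κ i) (cl i)) :
    -- expansions of rings without zero divisors have uniformly definable dimension
    ((∃ s : ExistentialMatroid.RingSymbols L,
        ∀ i, ExistentialMatroid.ExpandsDomain s (K i)) →
      ExistentialMatroid.UniformlyDefinable L cl) ∧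
    (ExistentialMatroid.UniformlyDefinable L cl →
      -- the ultralimit of the dimensions is well defined
      (∀ (n : ℕ) (X : Set (Fin n → (μ : Filter I).Product K)), univ.Definable L X →
        (∃ Y : ∀ i, Set (Fin n → K i), (∀ i, univ.Definable L (Y i)) ∧
          X = ExistentialMatroid.ultraSet μ Y) ∧
        ∀ Y : ∀ i, Set (Fin n → K i), (∀ i, univ.Definable L (Y i)) →
          X = ExistentialMatroid.ultraSet μ Y →
          ∀ᶠ i in (μ : Filter I), ExistentialMatroid.inducedDim (j i) (cl i) n (Y i) =
            ExistentialMatroid.limitDim μ j cl n X) ∧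
      -- it is a dimension function
      ExistentialMatroid.IsDimensionFunction L (ExistentialMatroid.limitDim μ j cl) ∧
      -- it induces an existential matroid, on every monster model extending the ultraproduct
      (∀ (N : Type z) [L.Structure N] (e : (μ : Filter I).Product K ↪ₑ[L] N) (ν : Cardinal.{z}),
        ExistentialMatroid.IsMonster L ν N →
        (∃ d' : ∀ n : ℕ, Set (Fin n → N) → WithBot ℕ,
          ExistentialMatroid.IsDimensionFunction L d' ∧
          ExistentialMatroid.ExtendsDim e (ExistentialMatroid.limitDim μ j cl) d') ∧
        ∀ d' : ∀ n : ℕ, Set (Fin n → N) → WithBot ℕ,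
          ExistentialMatroid.IsDimensionFunction L d' →
          ExistentialMatroid.ExtendsDim e (ExistentialMatroid.limitDim μ j cl) d' →
          ExistentialMatroid.IsExistentialMatroid L ν (ExistentialMatroid.matroidOfDim L d') ∧
          (∀ (n : ℕ) (X : Set (Fin n → N)), univ.Definable L X →
            ExistentialMatroid.dim L (ExistentialMatroid.matroidOfDim L d') X = d' n X) ∧
          ∀ A : Set ((μ : Filter I).Product K),
            e ⁻¹' ExistentialMatroid.matroidOfDim L d' (e '' A) =
              ExistentialMatroid.matroidOfDim L (ExistentialMatroid.limitDim μ j cl) A) ∧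
      -- membership in the induced matroid implies membership almost everywhere
      (∀ (a : ∀ i, K i) (m : ℕ) (b : Fin m → ∀ i, K i),
        ExistentialMatroid.ultraMk μ a ∈
          ExistentialMatroid.matroidOfDim L (ExistentialMatroid.limitDim μ j cl)
            (range fun k => ExistentialMatroid.ultraMk μ (b k)) →
        ∀ᶠ i in (μ : Filter I), j i (a i) ∈ cl i (range fun k => j i (b k i)))) ∧
    -- the converse implication fails for some family with uniformly definable dimension
    (∃ (L₀ : FirstOrder.Language.{0, 0}) (I₀ : Type) (_ : Infinite I₀) (μ₀ : Ultrafilter I₀)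
      (K₀ : I₀ → Type) (_ : ∀ i, L₀.Structure (K₀ i))
      (M₀ : I₀ → Type) (_ : ∀ i, L₀.Structure (M₀ i)) (j₀ : ∀ i, K₀ i ↪ₑ[L₀] M₀ i)
      (κ₀ : I₀ → Cardinal.{0}) (cl₀ : ∀ i, Set (M₀ i) → Set (M₀ i)),
      (∀ i, ExistentialMatroid.IsMonster L₀ (κ₀ i) (M₀ i)) ∧
      (∀ i, ExistentialMatroid.IsExistentialMatroid L₀ (κ₀ i) (cl₀ i)) ∧
      ExistentialMatroid.UniformlyDefinable L₀ cl₀ ∧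
      ∃ (a : ∀ i, K₀ i) (m : ℕ) (b : Fin m → ∀ i, K₀ i),
        (∀ᶠ i in (μ₀ : Filter I₀), j₀ i (a i) ∈ cl₀ i (range fun k => j₀ i (b k i))) ∧
        ExistentialMatroid.ultraMk μ₀ a ∉
          ExistentialMatroid.matroidOfDim L₀ (ExistentialMatroid.limitDim μ₀ j₀ cl₀)
            (range fun k => ExistentialMatroid.ultraMk μ₀ (b k))) := by
  have hne : ∀ i, Nonempty (M i) := fun i => (hcl i).nonempty
  have hneK : ∀ i, Nonempty (K i) := fun i => ExistentialMatroid.nonempty_of_elementary (j i)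
  refine ⟨fun ⟨s, hs⟩ => ExistentialMatroid.uniformlyDefinable_of_expandsDomain j hM hcl s hs,
    fun hU => ?_, ?_⟩
  · obtain ⟨Ψ, hΨ⟩ := hU.exists_represents hM hcl
    have hdim : ∀ i, ExistentialMatroid.IsDimensionFunction L
        fun n (V : Set (Fin n → M i)) => ExistentialMatroid.dim L (cl i) V := fun i =>
      (hcl i).isDimensionFunction (hM i) fun m φ l _ => ⟨Ψ 1 m φ l, fun b => (hΨ i).2 1 m φ l b⟩
    have hlim := ExistentialMatroid.represents_limitDim (μ := μ) (j := j) hM hcl hΨ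
    have hinh : ExistentialMatroid.Inherits L M ((μ : Filter I).Product K) :=
      ExistentialMatroid.inherits_ultraproduct j
    refine ⟨fun n X hX => ⟨ExistentialMatroid.exists_ultraSet hX, ?_⟩,
      ExistentialMatroid.isDimensionFunction_of_represents hinh hdim hΨ hlim, ?_,
      fun a m b h => ExistentialMatroid.eventually_mem_cl hM hcl h⟩
    · rintro Y hY rfl
      exact ExistentialMatroid.eventually_eq_limitDim hM hcl hY
    · intro N _ e ν hN
      have hinhN := hinh.trans_elementary e
      have hrep := ExistentialMatroid.represents_dimOfFormulas hinhN hΨ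
      refine ⟨⟨_, ExistentialMatroid.isDimensionFunction_of_represents hinhN hdim hΨ hrep,
        ExistentialMatroid.extendsDim_of_represents hlim hrep e⟩, fun d' hd' hext => ?_⟩
      exact ⟨hd'.isExistentialMatroid hN, fun n X hX => hd'.dim_matroidOfDim hN hX,
        fun A => ExistentialMatroid.preimage_matroidOfDim hext A⟩
  -- The reals serve only as an uncountable set, with the natural numbers as distinct named points.
  · let _ : ExistentialMatroid.pointLanguage.Structure ℝ :=
      FirstOrder.Language.constantsOn.structure fun k : ℕ => (k : ℝ)
    have hR : ℵ₀ < #ℝ := by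
      rw [Cardinal.mk_real]
      exact Cardinal.aleph0_lt_continuum
    refine ⟨ExistentialMatroid.pointLanguage, ℕ, inferInstance, hyperfilter ℕ, fun _ => ℝ,
      fun _ => inferInstance, fun _ => ℝ, fun _ => inferInstance,
      fun _ => FirstOrder.Language.ElementaryEmbedding.refl _ ℝ, fun _ => #ℝ,
      fun _ => ExistentialMatroid.pointClosure, fun _ => ExistentialMatroid.isMonster_point hR,
      fun _ => ExistentialMatroid.isExistentialMatroid_point hR,
      ExistentialMatroid.uniformlyDefinable_point hR ℕ,
      fun i => ExistentialMatroid.point ℝ i, 0, fun k => k.elim0,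
      Eventually.of_forall fun i => Or.inr ⟨i, rfl⟩, ?_⟩
    exact ExistentialMatroid.point_notMem_matroidOfDim hR fun _ _ h => Nat.cast_injective h
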